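/- For $\zeta>0$ let $K(\zeta)$ be the integral operator on $L^2(-1,1)$ with kernel $\frac{\sin \zeta\pi(x-t)}{\pi(x-t)}$ (equal to $\zeta$ at $x=t$), and let $$P(\zeta,1)=\det(I-K(\zeta))=\sum_{n=0}^{\infty}\frac{(-1)^n}{n!}\int_{[-1,1]^n}\det\Big[\tfrac{\sin \zeta\pi(x_i-x_j)}{\pi(x_i-x_j)}\Big]_{i,j=1}^n\,dx_1\cdots dx_n$$ be its Fredholm determinant. On $L^2(-\zeta,\zeta)$ put $(C_\zeta f)(x)=f(x)-\int_{-\zeta}^{\zeta}\frac{\sin\pi(x-y)}{\pi(x-y)}f(y)\,dy$ (the kernel being $1$ at $x=y$). Then $C_\zeta$ is invertible and its inverse has the form $(C_\zeta^{-1}f)(x)=f(x)+\int_{-\zeta}^{\zeta}Q_\zeta(x,y)f(y)\,dy$ with $Q_\zeta$ continuous on $[-\zeta,\zeta]^2$. With $$r(\zeta)=e^{i\pi\zeta}+\int_{-\zeta}^{\zeta}Q_\zeta(-\zeta,s)e^{-i\pi s}\,ds,$$ for every $\zeta>0$ one has $P(\zeta,1)>0$, the function $\log P(\cdot,1)$ is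 differentiable at $\zeta$, the function $|r^2|$ is integrable on $(0,\zeta)$, and $$\zeta\,\frac{d}{d\zeta}\log P(\zeta,1)=-2\int_0^{\zeta}|r^2(s)|\,ds .$$ -/

import Mathlib

open MeasureTheory

/-- The Fredholm determinant `det (I - lam K)` of the integral operator `K` on `L²(a, b)` with
continuous kernel `k`, given by Fredholm's series
`∑ₙ ((-lam)ⁿ / n!) ∫_{[a,b]ⁿ} det (k (xᵢ, xⱼ)) dx₁ … dxₙ`. -/
noncomputable def fredholmDet (a b : ℝ) (k : ℝ → ℝ → ℝ) (lam : ℝ) : ℝ :=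
  ∑' n : ℕ, ((-lam) ^ n / (n.factorial : ℝ)) *
    ∫ x in (Set.univ : Set (Fin n)).pi (fun _ => Set.Icc a b),
      (Matrix.of fun i j : Fin n => k (x i) (x j)).det

/-- The kernel `sin (ζ π (x - t)) / (π (x - t))`, with its continuous value `ζ` at `x = t`. -/
noncomputable def sineKernel (ζ x t : ℝ) : ℝ :=
  ζ * Real.sinc (ζ * Real.pi * (x - t))

/-- `P(ζ, lam) = det (I - lam K(ζ))`, where `K(ζ)` is the operator on `L²(-1, 1)` with kernel
`sin (ζ π (x - t)) / (π (x - t))`. -/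
noncomputable def sineDet (ζ lam : ℝ) : ℝ :=
  fredholmDet (-1) 1 (sineKernel ζ) lam

/-- The integral operator `(K f)(x) = ∫_{-ζ}^{ζ} k(x, y) f(y) dy`, on complex functions. -/
noncomputable def intOp (ζ : ℝ) (k : ℝ → ℝ → ℂ) (f : ℝ → ℂ) (x : ℝ) : ℂ :=
  ∫ y in (-ζ)..ζ, k x y * f y

/-- The operator `(C_ζ f)(x) = f(x) - ∫_{-ζ}^{ζ} k(x - y) f(y) dy` with
`k(x) = sin (π x) / (π x)`, `k(0) = 1`. -/
noncomputable def sineOp (ζ : ℝ) (f : ℝ → ℂ) (x : ℝ) : ℂ :=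
  f x - intOp ζ (fun x y => (Real.sinc (Real.pi * (x - y)) : ℂ)) f x

/-- `Q` is the resolvent kernel of `C_ζ`: it is continuous on `[-ζ, ζ]²`, and
`f ↦ f(x) + ∫_{-ζ}^{ζ} Q(x, y) f(y) dy` is the two-sided inverse of `C_ζ` on `L²(-ζ, ζ)`
(functions in `L²` being identified when they agree almost everywhere). -/
structure IsSineResolventKernel (ζ : ℝ) (Q : ℝ → ℝ → ℂ) : Prop where
  continuousOn : ContinuousOn (fun p : ℝ × ℝ => Q p.1 p.2)
    (Set.Icc (-ζ) ζ ×ˢ Set.Icc (-ζ) ζ)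
  right_inv : ∀ f : ℝ → ℂ, MemLp f 2 (volume.restrict (Set.Icc (-ζ) ζ)) →
    ∀ᵐ x ∂(volume.restrict (Set.Icc (-ζ) ζ)),
      sineOp ζ (fun y => f y + intOp ζ Q f y) x = f x
  left_inv : ∀ f : ℝ → ℂ, MemLp f 2 (volume.restrict (Set.Icc (-ζ) ζ)) →
    ∀ᵐ x ∂(volume.restrict (Set.Icc (-ζ) ζ)),
      sineOp ζ f x + intOp ζ Q (sineOp ζ f) x = f x

open Classical in
/-- The resolvent kernel `Q_ζ` of `C_ζ`. The two-sided inverse is unique and `Q_ζ` is continuous,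
so its values on `[-ζ, ζ]²` do not depend on the choice; it is `0` if there is no such kernel. -/
noncomputable def sineResolvent (ζ : ℝ) : ℝ → ℝ → ℂ :=
  if h : ∃ Q : ℝ → ℝ → ℂ, IsSineResolventKernel ζ Q then h.choose else fun _ _ => 0

/-- `r(ζ) = e^{iπζ} + ∫_{-ζ}^{ζ} Q_ζ(-ζ, s) e^{-iπs} ds`. -/
noncomputable def sineR (ζ : ℝ) : ℂ :=
  Complex.exp (Complex.I * ζ * Real.pi) +
    ∫ s in (-ζ)..ζ, sineResolvent ζ (-ζ) s * Complex.exp (-(Complex.I * s * Real.pi))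

/-!
Let `T_z` be the resolvent kernel of the sine kernel of bandwidth `z` on `[-1, 1]`; then
`T_z = z Q_z` after rescaling. The derivative in `z` of the kernel is the rank-two kernel
`cos ⊗ cos + sin ⊗ sin`, so the derivative of `T_z(-1, -1)` is
`((1 - K(z))⁻¹ cos)(-1)² + ((1 - K(z))⁻¹ sin)(-1)² = |r(z)|²`. Since `T_0 = 0`, this gives
`z Q_z(-z, -z) = ∫_0^z |r|²`.

On the other side, splitting Fredholm's series according to which variable is smallest gives, by
translation invariance, `P(z, 1) = 1 - 2 ∫_0^z D_t(-t, -t) dt` for the first Fredholm minor `D_t` on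
`[-t, t]`, and Fredholm's equation says `D_t = P(t, 1) Q_t`. Hence `P' = -2 P Q_z(-z, -z)`, and an
integrating factor yields `P > 0`.

The operator `1 - K(z)` is invertible because `K(z)` is compact and has no nonzero fixed point: by
Parseval the Fourier transform of a fixed point vanishes off a bounded interval, whereas it is
entire.
-/

namespace SineKernel

open MeasureTheory Set Filter Topology

/-! ### Families of operators with Gram kernels -/

section Gram

variable {E : Type*} [NormedAddCommGroup E] [NormedSpace ℝ E]

/-- The operator `g ↦ B(f, g) f`. -/
noncomputable def rankOne (B : E →L[ℝ] E →L[ℝ] ℝ) (f : E) : E →L[ℝ] E := (B f).smulRight f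

theorem rankOne_apply (B : E →L[ℝ] E →L[ℝ] ℝ) (f g : E) : rankOne B f g = B f g • f := rfl

theorem continuous_rankOne (B : E →L[ℝ] E →L[ℝ] ℝ) : Continuous (rankOne B) := by
  change Continuous fun f => ContinuousLinearMap.smulRightL ℝ E E (B f) f
  fun_prop

theorem isCompactOperator_rankOne (B : E →L[ℝ] E →L[ℝ] ℝ) (f : E) :
    IsCompactOperator (rankOne B f) :=
  ((isCompactOperator_id (E := ℝ)).comp_clm (B f)).clm_comp
    ((ContinuousLinearMap.id ℝ ℝ).smulRight f)

variable {ι : Type*} [Fintype ι] (B : E →L[ℝ] E →L[ℝ] ℝ) (φ : ι → C(ℝ, E))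

/-- The operator `∫₀ᶻ ∑ i, φ i w ⊗ φ i w dw`, the tensors being identified with operators by means
of the bilinear form `B`. -/
noncomputable def gramOperator (z : ℝ) : E →L[ℝ] E :=
  ∫ w in (0 : ℝ)..z, ∑ i, rankOne B (φ i w)

/-- The vector `∫₀ᶻ ∑ i, e (φ i w) φ i w dw` that represents the functional
`e ∘ gramOperator B φ z`. When `E` is a space of functions and `e` the evaluation at `x`, it is the
section at `x` of the kernel of the operator. -/
noncomputable def gramVector (z : ℝ) (e : E →L[ℝ] ℝ) : E :=
  ∫ w in (0 : ℝ)..z, ∑ i, e (φ i w) • φ i w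

theorem continuous_sum_rankOne : Continuous fun w => ∑ i, rankOne B (φ i w) :=
  continuous_finsetSum _ fun i _ => (continuous_rankOne B).comp (φ i).continuous

theorem gramVector_zero (e : E →L[ℝ] ℝ) : gramVector φ 0 e = 0 := intervalIntegral.integral_same

/-- The vector that represents the functional `e ∘ ((1 - gramOperator B φ z)⁻¹ - 1)`; for the
evaluation at `y` in a space of functions, the section at `y` of the resolvent kernel. It has this
meaning only if `1 - gramOperator B φ z` is invertible. -/
noncomputable def resolventVector (z : ℝ) (e : E →L[ℝ] ℝ) : E :=
  Ring.inverse (1 - gramOperator B φ z) (gramVector φ z e)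

theorem resolventVector_zero (e : E →L[ℝ] ℝ) : resolventVector B φ 0 e = 0 := by
  rw [resolventVector, gramVector_zero, map_zero]

variable {B φ} in
theorem inverse_one_sub_eq {z : ℝ} (hz : IsUnit (1 - gramOperator B φ z)) (f : E) :
    Ring.inverse (1 - gramOperator B φ z) f =
      f + gramOperator B φ z (Ring.inverse (1 - gramOperator B φ z) f) := by
  have h := DFunLike.congr_fun (Ring.mul_inverse_cancel _ hz) f
  simpa [sub_eq_iff_eq_add] using h

variable [CompleteSpace E]

theorem intervalIntegral_mem {S : Submodule ℝ E} (hS : IsClosed (S : Set E)) {F : ℝ → E}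
    (hF : Continuous F) (hFS : ∀ w, F w ∈ S) (a b : ℝ) : ∫ w in a..b, F w ∈ S := by
  have : CompleteSpace S := hS.completeSpace_coe
  have hG : Continuous fun w => (⟨F w, hFS w⟩ : S) := hF.subtype_mk hFS
  have h := S.subtypeL.intervalIntegral_comp_comm (hG.intervalIntegrable (μ := volume) a b)
  exact h ▸ Subtype.coe_prop _

theorem hasDerivAt_gramOperator (z : ℝ) :
    HasDerivAt (gramOperator B φ) (∑ i, rankOne B (φ i z)) z :=
  ((continuous_sum_rankOne B φ).integral_hasStrictDerivAt 0 z).hasDerivAt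

theorem hasDerivAt_gramVector (z : ℝ) (e : E →L[ℝ] ℝ) :
    HasDerivAt (fun z => gramVector φ z e) (∑ i, e (φ i z) • φ i z) z :=
  Continuous.integral_hasStrictDerivAt (by fun_prop) 0 z |>.hasDerivAt

theorem apply_gramVector (z : ℝ) (e e' : E →L[ℝ] ℝ) :
    e' (gramVector φ z e) = ∫ w in (0 : ℝ)..z, ∑ i, e (φ i w) * e' (φ i w) := by
  have hF : Continuous fun w => ∑ i, e (φ i w) • φ i w := by fun_prop
  have h := e'.intervalIntegral_comp_comm (hF.intervalIntegrable (μ := volume) 0 z)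
  simpa [gramVector] using h.symm

theorem gramOperator_apply (z : ℝ) (f : E) :
    gramOperator B φ z f = ∫ w in (0 : ℝ)..z, ∑ i, B (φ i w) f • φ i w := by
  have h := (ContinuousLinearMap.apply ℝ E f).intervalIntegral_comp_comm
    ((continuous_sum_rankOne B φ).intervalIntegrable (μ := volume) 0 z)
  simpa [gramOperator, rankOne_apply] using h.symm

theorem apply_gramOperator (z : ℝ) (f : E) (e : E →L[ℝ] ℝ) :
    e (gramOperator B φ z f) = ∫ w in (0 : ℝ)..z, ∑ i, B (φ i w) f * e (φ i w) := by
  have hF : Continuous fun w => ∑ i, B (φ i w) f • φ i w := by fun_prop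
  have h := e.intervalIntegral_comp_comm (hF.intervalIntegrable (μ := volume) 0 z)
  simpa [gramOperator_apply] using h.symm

theorem apply_gramOperator_eq (z : ℝ) (f : E) (e : E →L[ℝ] ℝ) :
    e (gramOperator B φ z f) = B (gramVector φ z e) f := by
  rw [apply_gramOperator, ← ContinuousLinearMap.flip_apply, apply_gramVector]
  simp only [mul_comm, ContinuousLinearMap.flip_apply]

theorem isCompactOperator_gramOperator (z : ℝ) : IsCompactOperator (gramOperator B φ z) :=
  intervalIntegral_mem (S := compactOperator (RingHom.id ℝ) E E)
    isClosed_setOfPred_isCompactOperator (continuous_sum_rankOne B φ)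
    (fun w => Submodule.sum_mem _ fun i _ => isCompactOperator_rankOne B (φ i w)) 0 z

theorem isUnit_one_sub_gramOperator {z : ℝ} (h : ∀ f, gramOperator B φ z f = f → f = 0) :
    IsUnit (1 - gramOperator B φ z) := by
  rcases (isCompactOperator_gramOperator B φ z).hasEigenvalue_or_mem_resolventSet
    (one_ne_zero (α := ℝ)) with h1 | h1
  · obtain ⟨f, hf, hne⟩ := h1.exists_hasEigenvector
    exact absurd (h f (by simpa using Module.End.mem_eigenspace_iff.1 hf)) hne
  · simpa [spectrum.mem_resolventSet_iff] using h1

variable {B φ} {z : ℝ}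

theorem apply_resolventVector (hz : IsUnit (1 - gramOperator B φ z)) (e e' : E →L[ℝ] ℝ) :
    e' (resolventVector B φ z e) =
      e' (gramVector φ z e) + B (gramVector φ z e') (resolventVector B φ z e) := by
  conv_lhs => rw [resolventVector, inverse_one_sub_eq hz, map_add, apply_gramOperator_eq]
  rfl

theorem gramOperator_comm (hB : ∀ f g, B f g = B g f) (f g : E) :
    B (gramOperator B φ z f) g = B f (gramOperator B φ z g) := by
  rw [hB, apply_gramOperator, apply_gramOperator]
  simp only [hB g, hB f, mul_comm]

theorem inverse_one_sub_comm (hB : ∀ f g, B f g = B g f) (hz : IsUnit (1 - gramOperator B φ z))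
    (f g : E) : B (Ring.inverse (1 - gramOperator B φ z) f) g =
      B f (Ring.inverse (1 - gramOperator B φ z) g) := by
  have hf := inverse_one_sub_eq hz f
  have hg := inverse_one_sub_eq hz g
  set F := Ring.inverse (1 - gramOperator B φ z) f
  set G := Ring.inverse (1 - gramOperator B φ z) g
  rw [eq_sub_of_add_eq hf.symm, eq_sub_of_add_eq hg.symm]
  simp [gramOperator_comm hB]

theorem apply_inverse_one_sub (hB : ∀ f g, B f g = B g f) (hz : IsUnit (1 - gramOperator B φ z))
    (f : E) (e : E →L[ℝ] ℝ) : e (Ring.inverse (1 - gramOperator B φ z) f) =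
      e f + B (resolventVector B φ z e) f := by
  conv_lhs => rw [inverse_one_sub_eq hz, map_add, apply_gramOperator_eq,
    ← inverse_one_sub_comm hB hz]
  rfl

theorem resolventVector_comm (hB : ∀ f g, B f g = B g f) (hz : IsUnit (1 - gramOperator B φ z))
    (e e' : E →L[ℝ] ℝ) : e' (resolventVector B φ z e) = e (resolventVector B φ z e') := by
  rw [apply_resolventVector hz e, apply_resolventVector hz e']
  congr 1
  · simp only [apply_gramVector, mul_comm]
  · rw [resolventVector, ← inverse_one_sub_comm hB hz, hB, resolventVector]

theorem hasDerivAt_inverse_one_sub (hz : IsUnit (1 - gramOperator B φ z)) :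
    HasDerivAt (fun z => Ring.inverse (1 - gramOperator B φ z))
      (Ring.inverse (1 - gramOperator B φ z) * (∑ i, rankOne B (φ i z)) *
        Ring.inverse (1 - gramOperator B φ z)) z := by
  obtain ⟨u, hu⟩ := hz
  have h := hasFDerivAt_ringInverse (𝕜 := ℝ) u
  rw [hu] at h
  refine (h.comp_hasDerivAt z ((hasDerivAt_gramOperator B φ z).const_sub 1)).congr_deriv ?_
  rw [← hu, Ring.inverse_unit]
  simp only [neg_apply, ContinuousLinearMap.mulLeftRight_apply, mul_neg, neg_mul, neg_neg]

theorem hasDerivAt_apply_resolventVector (hB : ∀ f g, B f g = B g f)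
    (hz : IsUnit (1 - gramOperator B φ z)) (e : E →L[ℝ] ℝ) :
    HasDerivAt (fun z => e (resolventVector B φ z e))
      (∑ i, e (Ring.inverse (1 - gramOperator B φ z) (φ i z)) ^ 2) z := by
  have h := e.hasFDerivAt.comp_hasDerivAt z
    ((hasDerivAt_inverse_one_sub hz).clm_apply (hasDerivAt_gramVector φ z e))
  refine h.congr_deriv ?_
  have hrefold : Ring.inverse (1 - gramOperator B φ z) (gramVector φ z e) =
    resolventVector B φ z e := rfl
  simp only [mul_apply_eq_comp, sum_apply, rankOne_apply, map_add,
    map_sum, map_smul, smul_eq_mul, ← Finset.sum_add_distrib, hrefold]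
  refine Finset.sum_congr rfl fun i _ => ?_
  rw [hB (φ i z)]
  linear_combination
    -e (Ring.inverse (1 - gramOperator B φ z) (φ i z)) * apply_inverse_one_sub hB hz (φ i z) e

end Gram

/-! ### Continuous functions on `[-1, 1]` -/

/-- The interval `[-1, 1]`, with Lebesgue measure. -/
abbrev 𝕁 : Set ℝ := Icc (-1) 1

attribute [local instance] Measure.Subtype.measureSpace

theorem integral_𝕁 {F : Type*} [NormedAddCommGroup F] [NormedSpace ℝ F] (f : ℝ → F) :
    ∫ x : 𝕁, f x = ∫ x in (-1 : ℝ)..1, f x := by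
  rw [intervalIntegral.integral_of_le (by norm_num), ← integral_Icc_eq_integral_Ioc]
  exact integral_subtype_comap measurableSet_Icc f

instance : IsFiniteMeasure (volume : Measure 𝕁) := ⟨by
  rw [Measure.Subtype.volume_univ measurableSet_Icc.nullMeasurableSet]
  exact isCompact_Icc.measure_lt_top⟩

/-- Integration over `[-1, 1]`, as a functional on the Banach space of continuous functions. -/
noncomputable def integralL (𝕜 : Type*) [RCLike 𝕜] : C(𝕁, 𝕜) →L[𝕜] 𝕜 :=
  have hint (f : C(𝕁, 𝕜)) : Integrable f :=
    f.continuous.integrable_of_hasCompactSupport (HasCompactSupport.of_compactSpace _)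
  LinearMap.mkContinuous
    { toFun := fun f => ∫ x, f x
      map_add' := fun f g => integral_add (hint f) (hint g)
      map_smul' := fun c f => integral_const_mul c f }
    ((volume : Measure 𝕁).real univ) fun f => by
      rw [mul_comm]
      exact norm_integral_le_of_norm_le_const (.of_forall f.norm_coe_le_norm)

theorem integralL_apply {𝕜 : Type*} [RCLike 𝕜] (f : C(𝕁, 𝕜)) : integralL 𝕜 f = ∫ x, f x := rfl

/-- The bilinear form `⟨f, g⟩ = ∫ f g` on `C([-1, 1])`. -/
noncomputable def pairing : C(𝕁, ℝ) →L[ℝ] C(𝕁, ℝ) →L[ℝ] ℝ :=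
  (ContinuousLinearMap.compL ℝ C(𝕁, ℝ) C(𝕁, ℝ) ℝ (integralL ℝ)).comp
    (ContinuousLinearMap.mul ℝ C(𝕁, ℝ))

theorem pairing_apply (f g : C(𝕁, ℝ)) : pairing f g = ∫ x, f x * g x := rfl

theorem pairing_comm (f g : C(𝕁, ℝ)) : pairing f g = pairing g f := by
  simp only [pairing_apply, mul_comm]

theorem pairing_eq (f g : C(𝕁, ℝ)) : pairing f g =
    ∫ x in (-1 : ℝ)..1, IccExtend (by norm_num) f x * IccExtend (by norm_num) g x := by
  simp [pairing_apply, ← integral_𝕁]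

theorem eq_zero_of_pairing_self_eq_zero {f : C(𝕁, ℝ)} (h : pairing f f = 0) : f = 0 := by
  have hg : Continuous (IccExtend (by norm_num : (-1 : ℝ) ≤ 1) f) := f.continuous.Icc_extend'
  ext x
  by_contra hx
  refine (intervalIntegral.integral_pos (by norm_num) (hg.mul hg).continuousOn
    (fun y _ => mul_self_nonneg _) ⟨x, x.2, ?_⟩).ne' ((pairing_eq f f).symm.trans h)
  simpa using mul_self_pos.2 hx

/-- The curves `w ↦ cos (w π ·)` and `w ↦ sin (w π ·)` in `C([-1, 1])`. -/
noncomputable def waves : Fin 2 → C(ℝ, C(𝕁, ℝ)) :=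
  ![ContinuousMap.curry ⟨fun p : ℝ × 𝕁 => Real.cos (p.1 * Real.pi * p.2), by fun_prop⟩,
    ContinuousMap.curry ⟨fun p : ℝ × 𝕁 => Real.sin (p.1 * Real.pi * p.2), by fun_prop⟩]

theorem waves_zero_apply (w : ℝ) (x : 𝕁) : waves 0 w x = Real.cos (w * Real.pi * x) := rfl

theorem waves_one_apply (w : ℝ) (x : 𝕁) : waves 1 w x = Real.sin (w * Real.pi * x) := rfl

/-- The integral operator with kernel `sineKernel z` on `C([-1, 1])`. -/
noncomputable abbrev sineOperator (z : ℝ) : C(𝕁, ℝ) →L[ℝ] C(𝕁, ℝ) := gramOperator pairing waves z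

theorem integral_cos_mul (z u : ℝ) :
    ∫ w in (0 : ℝ)..z, Real.cos (w * u) = z * Real.sinc (z * u) := by
  rcases eq_or_ne u 0 with rfl | hu
  · simp
  rcases eq_or_ne z 0 with rfl | hz
  · simp
  rw [intervalIntegral.integral_comp_mul_right _ hu, integral_cos,
    Real.sinc_of_ne_zero (mul_ne_zero hz hu), zero_mul, Real.sin_zero, smul_eq_mul]
  field_simp
  ring

theorem gramVector_waves_apply (z : ℝ) (x y : 𝕁) :
    gramVector waves z (ContinuousMap.evalCLM ℝ x) y = sineKernel z x y := by
  have h := apply_gramVector waves z (ContinuousMap.evalCLM ℝ x) (ContinuousMap.evalCLM ℝ y)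
  simp only [ContinuousMap.evalCLM_apply, Fin.sum_univ_two, waves_zero_apply, waves_one_apply,
    ← Real.cos_sub] at h
  rw [h, sineKernel, mul_assoc z, ← integral_cos_mul]
  refine intervalIntegral.integral_congr fun w _ => ?_
  ring_nf

/-! ### Invertibility of `1 - sineOperator z` -/

/-- The Fourier transform `∫ f(x) exp(i w π x) dx`, as a function of a complex frequency `w`. The
exponential is taken in the Banach algebra `C([-1, 1])`. -/
noncomputable def fourierTransform (f : C(𝕁, ℝ)) (w : ℂ) : ℂ :=
  integralL ℂ ((⟨fun x => f x, by fun_prop⟩ : C(𝕁, ℂ)) *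
    NormedSpace.exp (w • (⟨fun x => Complex.I * Real.pi * x, by fun_prop⟩ : C(𝕁, ℂ))))

theorem fourierTransform_eq (f : C(𝕁, ℝ)) (w : ℂ) :
    fourierTransform f w = ∫ x : 𝕁, f x * Complex.exp (w * (Complex.I * Real.pi * x)) := by
  simp [fourierTransform, integralL_apply, NormedSpace.exp_continuousMap_eq, Complex.exp_eq_exp_ℂ]

theorem differentiable_mul_exp_smul {A : Type*} [NormedRing A] [NormedAlgebra ℂ A]
    [CompleteSpace A] (L : A →L[ℂ] ℂ) (a b : A) :
    Differentiable ℂ fun w : ℂ => L (a * NormedSpace.exp (w • b)) :=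
  L.differentiable.comp ((differentiable_exp_smul_const ℂ b).const_mul a)

theorem differentiable_fourierTransform (f : C(𝕁, ℝ)) : Differentiable ℂ (fourierTransform f) :=
  differentiable_mul_exp_smul (integralL ℂ) _ _

theorem fourierTransform_ofReal (f : C(𝕁, ℝ)) (w : ℝ) :
    fourierTransform f w = pairing (waves 0 w) f + pairing (waves 1 w) f * Complex.I := by
  have hint (g : C(𝕁, ℝ)) : Integrable fun x : 𝕁 => ((g x * f x : ℝ) : ℂ) :=
    Continuous.integrable_of_hasCompactSupport (by fun_prop) (.of_compactSpace _)
  rw [pairing_apply, pairing_apply, ← integral_complex_ofReal, ← integral_complex_ofReal,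
    ← integral_mul_const, ← integral_add (hint _) ((hint _).mul_const _), fourierTransform_eq]
  congr 1 with x
  rw [show (w : ℂ) * (Complex.I * Real.pi * x) = ((w * Real.pi * x : ℝ) : ℂ) * Complex.I by
    push_cast; ring, Complex.exp_mul_I, waves_zero_apply, waves_one_apply]
  push_cast
  ring

theorem norm_fourierTransform_sq (f : C(𝕁, ℝ)) (w : ℝ) : ‖fourierTransform f w‖ ^ 2 =
    pairing (waves 0 w) f ^ 2 + pairing (waves 1 w) f ^ 2 := by
  rw [fourierTransform_ofReal, ← Complex.normSq_eq_norm_sq, Complex.normSq_add_mul_I]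

theorem norm_fourierTransform_neg (f : C(𝕁, ℝ)) (w : ℝ) :
    ‖fourierTransform f (-w : ℝ)‖ = ‖fourierTransform f w‖ := by
  have h0 : waves 0 (-w) = waves 0 w := by ext x; simp [waves_zero_apply]
  have h1 : waves 1 (-w) = -waves 1 w := by ext x; simp [waves_one_apply]
  rw [← sq_eq_sq₀ (norm_nonneg _) (norm_nonneg _), norm_fourierTransform_sq,
    norm_fourierTransform_sq, h0, h1, map_neg, neg_apply, neg_sq]

theorem continuous_norm_fourierTransform_sq (f : C(𝕁, ℝ)) :
    Continuous fun w : ℝ => ‖fourierTransform f w‖ ^ 2 :=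
  ((differentiable_fourierTransform f).continuous.comp Complex.continuous_ofReal).norm.pow 2

theorem pairing_sineOperator_self (z : ℝ) (f : C(𝕁, ℝ)) :
    pairing (sineOperator z f) f = ∫ w in (0 : ℝ)..z, ‖fourierTransform f w‖ ^ 2 := by
  rw [pairing_comm, apply_gramOperator]
  simp only [norm_fourierTransform_sq, Fin.sum_univ_two, pairing_comm f]
  simp only [sq]

theorem hasSum_norm_fourierTransform_sq (f : C(𝕁, ℝ)) (θ : ℝ) :
    HasSum (fun n : ℤ => ‖fourierTransform f (θ - n : ℝ)‖ ^ 2) (2 * pairing f f) := by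
  have h11 : (-1 : ℝ) < 1 := by norm_num
  let F (x : ℝ) : ℂ := IccExtend h11.le f x * Complex.exp (θ * (Complex.I * Real.pi * x))
  have hF : Continuous F := by
    have := f.continuous.Icc_extend' (h := h11.le)
    fun_prop
  have hcoeff (n : ℤ) : fourierCoeffOn h11 F n = (1 / 2 : ℝ) • fourierTransform f (θ - n : ℝ) := by
    rw [fourierCoeffOn_eq_integral, fourierTransform_eq, ← integral_𝕁]
    congr 1
    · norm_num
    congr 1 with x
    rw [fourier_coe_apply, smul_eq_mul]
    simp only [F, IccExtend_val]
    rw [mul_left_comm, ← Complex.exp_add]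
    congr 2
    push_cast
    ring
  have hnorm (x : ℝ) : ‖F x‖ ^ 2 = IccExtend h11.le f x * IccExtend h11.le f x := by
    rw [norm_mul, show (θ : ℂ) * (Complex.I * Real.pi * x) = (θ * Real.pi * x : ℝ) * Complex.I by
      push_cast; ring, Complex.norm_exp_ofReal_mul_I, mul_one, Complex.norm_real,
      Real.norm_eq_abs, sq_abs, sq]
  have h := hasSum_sq_fourierCoeffOn h11 (f := F)
    ((memLp_two_iff_integrable_sq_norm hF.aestronglyMeasurable).2
      (hF.norm.pow 2).integrableOn_Ioc)
  simp only [hcoeff, hnorm, ← pairing_eq, norm_smul, mul_pow] at h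
  convert! h.mul_left 4 using 1
  · ext n
    norm_num [← mul_assoc]
  · norm_num
    ring

theorem sum_norm_fourierTransform_sq_le (f : C(𝕁, ℝ)) (θ : ℝ) (m : ℕ) :
    ∑ n ∈ Finset.range m, ‖fourierTransform f (θ + n : ℝ)‖ ^ 2 ≤ 2 * pairing f f := by
  have h := sum_le_hasSum ((Finset.range m).image fun n : ℕ => (-n : ℤ))
    (fun _ _ => sq_nonneg _) (hasSum_norm_fourierTransform_sq f θ)
  rw [Finset.sum_image fun _ _ _ _ hn => by simpa using hn] at h
  simpa only [Int.cast_neg, Int.cast_natCast, sub_neg_eq_add] using h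

theorem integral_norm_fourierTransform_sq_le (f : C(𝕁, ℝ)) (N : ℕ) :
    ∫ w in (0 : ℝ)..N, ‖fourierTransform f w‖ ^ 2 ≤ pairing f f := by
  set S : ℝ → ℝ := fun w => ‖fourierTransform f w‖ ^ 2 with hS
  have hSc : Continuous S := continuous_norm_fourierTransform_sq f
  have hint (a b : ℝ) : IntervalIntegrable S volume a b := hSc.intervalIntegrable a b
  have hshift (k : ℕ) : Continuous fun θ : ℝ => S (θ + k) := by fun_prop
  have hperiod : ∫ w in (-N : ℝ)..N, S w =
      ∫ θ in (-N : ℝ)..(-N + 1), ∑ k ∈ Finset.range (2 * N), S (θ + k) := by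
    rw [intervalIntegral.integral_finsetSum fun k _ => (hshift k).intervalIntegrable _ _]
    have h := intervalIntegral.sum_integral_adjacent_intervals (f := S) (μ := volume)
      (a := fun k : ℕ => (-N + k : ℝ)) (n := 2 * N) fun _ _ => hint _ _
    simp only [intervalIntegral.integral_comp_add_right S]
    rw [Nat.cast_zero, add_zero, Nat.cast_mul, Nat.cast_two, show (-N + 2 * N : ℝ) = N by ring] at h
    rw [← h]
    refine Finset.sum_congr rfl fun k _ => ?_
    rw [Nat.cast_succ, add_right_comm, add_assoc]
  have hneg : ∫ w in (-N : ℝ)..0, S w = ∫ w in (0 : ℝ)..N, S w := by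
    simpa only [hS, norm_fourierTransform_neg, neg_zero] using
      (intervalIntegral.integral_comp_neg (a := 0) (b := (N : ℝ)) S).symm
  have hle : ∫ w in (-N : ℝ)..N, S w ≤ 2 * pairing f f := by
    rw [hperiod]
    calc _ ≤ ∫ θ in (-N : ℝ)..(-N + 1), 2 * pairing f f :=
          intervalIntegral.integral_mono_on (by linarith)
            ((continuous_finsetSum _ fun k _ => hshift k).intervalIntegrable _ _)
            intervalIntegrable_const fun θ _ => sum_norm_fourierTransform_sq_le f θ (2 * N)
      _ = _ := by simp
  rw [← intervalIntegral.integral_add_adjacent_intervals (hint (-N) 0) (hint 0 N), hneg] at hle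
  linarith

theorem eq_zero_of_differentiable_of_forall_gt {F : ℂ → ℂ} (hF : Differentiable ℂ F) {z : ℝ}
    (h : ∀ w : ℝ, z < w → F w = 0) : F = 0 := by
  have hev : ∀ᶠ w : ℝ in 𝓝[≠] (z + 1), F w = 0 :=
    nhdsWithin_le_nhds (mem_of_superset (Ioi_mem_nhds (lt_add_one z)) h)
  have ht : Tendsto (fun x : ℝ => (x : ℂ)) (𝓝[≠] (z + 1)) (𝓝[≠] ((z + 1 : ℝ) : ℂ)) :=
    Complex.continuous_ofReal.continuousWithinAt.tendsto_nhdsWithin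
      fun _ hx => Complex.ofReal_injective.ne hx
  exact funext fun w => (hF.differentiableOn.analyticOnNhd isOpen_univ)
    |>.eqOn_zero_of_preconnected_of_frequently_eq_zero isPreconnected_univ (mem_univ _)
      (ht.frequently hev.frequently) (mem_univ w)

theorem eq_zero_of_sineOperator_apply_eq {z : ℝ} {f : C(𝕁, ℝ)} (h : sineOperator z f = f) :
    f = 0 := by
  have hcont := continuous_norm_fourierTransform_sq f
  have hE : pairing f f = ∫ w in (0 : ℝ)..z, ‖fourierTransform f w‖ ^ 2 := by
    rw [← pairing_sineOperator_self, h]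
  have hzero (w : ℝ) (hw : z < w) : fourierTransform f w = 0 := by
    by_contra hne
    obtain ⟨N, hN⟩ := exists_nat_gt w
    have hpos : 0 < ∫ w in z..N, ‖fourierTransform f w‖ ^ 2 :=
      intervalIntegral.integral_pos (hw.trans hN) hcont.continuousOn (fun _ _ => sq_nonneg _)
        ⟨w, ⟨hw.le, hN.le⟩, by positivity⟩
    have hle := integral_norm_fourierTransform_sq_le f N
    rw [← intervalIntegral.integral_add_adjacent_intervals (hcont.intervalIntegrable 0 z)
      (hcont.intervalIntegrable z N), ← hE] at hle
    linarith
  refine eq_zero_of_pairing_self_eq_zero ?_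
  rw [hE, eq_zero_of_differentiable_of_forall_gt (differentiable_fourierTransform f) hzero]
  simp

theorem isUnit_one_sub_sineOperator (z : ℝ) : IsUnit (1 - sineOperator z) :=
  isUnit_one_sub_gramOperator pairing waves fun _ => eq_zero_of_sineOperator_apply_eq

/-! ### Integrals over cubes -/

/-- The cube `[a, b]ⁿ`. -/
def cube (n : ℕ) (a b : ℝ) : Set (Fin n → ℝ) := (univ : Set (Fin n)).pi fun _ => Icc a b

theorem isCompact_cube (n : ℕ) (a b : ℝ) : IsCompact (cube n a b) :=
  isCompact_univ_pi fun _ => isCompact_Icc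

theorem volume_real_cube (n : ℕ) {a b : ℝ} (h : a ≤ b) :
    (volume : Measure (Fin n → ℝ)).real (cube n a b) = (b - a) ^ n := by
  rw [cube, pi_univ_Icc, Measure.real, Real.volume_Icc_pi_toReal fun _ => h]
  simp

theorem abs_setIntegral_cube_le {n : ℕ} {a b C : ℝ} (hab : a ≤ b) {g : (Fin n → ℝ) → ℝ}
    (hg : ∀ v, |g v| ≤ C) : |∫ v in cube n a b, g v| ≤ C * (b - a) ^ n := by
  rw [← volume_real_cube n hab]
  exact norm_setIntegral_le_of_norm_le_const (isCompact_cube n a b).measure_lt_top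
    fun v _ => (Real.norm_eq_abs _).trans_le (hg v)

theorem integrableOn_cube {n : ℕ} {a b : ℝ} {g : (Fin n → ℝ) → ℝ} (hg : Continuous g) :
    IntegrableOn g (cube n a b) :=
  hg.continuousOn.integrableOn_compact (isCompact_cube n a b)

theorem setIntegral_cube_zero (a b : ℝ) (g : (Fin 0 → ℝ) → ℝ) :
    ∫ v in cube 0 a b, g v = g default := by
  have h : (volume : Measure (Fin 0 → ℝ)).real (cube 0 a b) = 1 := by
    rw [cube, Subsingleton.elim (univ : Set (Fin 0)) ∅, empty_pi]
    simp [Measure.real, volume_pi]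
  rw [integral_unique, measureReal_restrict_apply_univ, h, one_smul]
  exact congrArg g (Subsingleton.elim _ _)

open scoped Pointwise in
theorem setIntegral_cube_affine {n : ℕ} {m : ℝ} (hm : 0 ≤ m) (a b c : ℝ)
    (g : (Fin n → ℝ) → ℝ) :
    ∫ v in cube n (c + m * a) (c + m * b), g v =
      m ^ n * ∫ v in cube n a b, g fun i => c + m * v i := by
  rcases Nat.eq_zero_or_pos n with rfl | hn
  · simp only [setIntegral_cube_zero, pow_zero, one_mul]
    congr 1
    exact Subsingleton.elim _ _
  rcases hm.eq_or_lt with rfl | hm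
  · have hnull : volume (cube n c c) = 0 := by
      rw [cube, volume_pi_pi]
      simp [hn.ne']
    simp [hn.ne', Measure.restrict_eq_zero.2 hnull]
  have hpre : (fun v => (fun _ => c : Fin n → ℝ) + v) ⁻¹' cube n (c + m * a) (c + m * b) =
      m • cube n a b := by
    ext v
    simp only [cube, mem_preimage, mem_smul_set_iff_inv_smul_mem₀ hm.ne', mem_univ_pi, mem_Icc,
      Pi.add_apply, Pi.smul_apply, smul_eq_mul, add_le_add_iff_left, le_inv_mul_iff₀ hm,
      inv_mul_le_iff₀ hm]
  have hsmul := Measure.setIntegral_comp_smul_of_pos (volume : Measure (Fin n → ℝ))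
    (fun v => g ((fun _ => c) + v)) (cube n a b) hm
  rw [← hpre, (measurePreserving_add_left volume _).setIntegral_preimage_emb
    (measurableEmbedding_addLeft _), Module.finrank_fin_fun, smul_eq_mul] at hsmul
  exact (mul_inv_cancel_left₀ (pow_ne_zero n hm.ne') _).symm.trans
    (congrArg (m ^ n * ·) hsmul).symm

theorem setIntegral_cube_succAbove {n : ℕ} {a b : ℝ} (j : Fin (n + 1))
    {g : ℝ × (Fin n → ℝ) → ℝ} (hg : IntegrableOn g (Icc a b ×ˢ cube n a b)) :
    ∫ v in cube (n + 1) a b, g (v j, j.removeNth v) =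
      ∫ s in Icc a b, ∫ v in cube n a b, g (s, v) := by
  have hpre : cube (n + 1) a b =
      MeasurableEquiv.piFinSuccAbove (fun _ : Fin (n + 1) => ℝ) j ⁻¹' (Icc a b ×ˢ cube n a b) := by
    ext v
    simp only [cube, mem_univ_pi, mem_preimage, mem_prod, j.forall_iff_succAbove]
    rfl
  rw [← setIntegral_prod (μ := volume) (ν := volume) g hg, ← Measure.volume_eq_prod,
    ← (volume_preserving_piFinSuccAbove (fun _ : Fin (n + 1) => ℝ) j).setIntegral_preimage_emb
      (MeasurableEquiv.measurableEmbedding _), ← hpre]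
  rfl

theorem ae_injective (ι : Type*) [Fintype ι] :
    ∀ᵐ v : ι → ℝ, Function.Injective v := by
  have hne : ∀ i j : ι, i ≠ j → ∀ᵐ v : ι → ℝ, v i ≠ v j := by
    classical
    intro i j hij
    let φ : (ι → ℝ) →ₗ[ℝ] ℝ := LinearMap.proj (R := ℝ) (φ := fun _ => ℝ) i - LinearMap.proj j
    have hφ : {v : ι → ℝ | ¬ v i ≠ v j} = (LinearMap.ker φ : Set (ι → ℝ)) := by
      ext v
      simp [φ, sub_eq_zero]
    rw [ae_iff, hφ]
    refine Measure.addHaar_submodule _ _ fun htop => ?_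
    have : φ (Pi.single i 1) = 0 := LinearMap.mem_ker.1 (htop ▸ Submodule.mem_top)
    simp [φ, hij.symm] at this
  filter_upwards [ae_all_iff.2 fun i => ae_all_iff.2 fun j =>
    eventually_imp_distrib_left.2 (hne i j)] with v hv i j hij
  exact not_imp_not.1 (hv i j) hij

/-- The set of points all of whose coordinates exceed the `j`-th one. -/
def minSet {n : ℕ} (j : Fin (n + 1)) : Set (Fin (n + 1) → ℝ) :=
  {v | ∀ i, v j < j.removeNth v i}

theorem measurableSet_minSet {n : ℕ} (j : Fin (n + 1)) : MeasurableSet (minSet j) := by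
  rw [show minSet j = ⋂ i, {v | v j < v (j.succAbove i)} by
    ext
    simp [minSet, Fin.removeNth]]
  exact MeasurableSet.iInter fun i => measurableSet_lt (by fun_prop) (by fun_prop)

theorem sum_indicator_minSet {n : ℕ} (F : (Fin (n + 1) → ℝ) → ℝ) {v : Fin (n + 1) → ℝ}
    (hv : Function.Injective v) : ∑ j, (minSet j).indicator F v = F v := by
  obtain ⟨j, hj⟩ := Finite.exists_min v
  have hjmem : v ∈ minSet j := fun i =>
    (hj _).lt_of_ne fun h => Fin.succAbove_ne j i (hv h).symm
  rw [Finset.sum_eq_single j (fun i _ hij => indicator_of_notMem (fun hi => ?_) F) (by simp),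
    indicator_of_mem hjmem]
  obtain ⟨p, hp⟩ := Fin.exists_succAbove_eq hij.symm
  exact (hj i).not_gt (by simpa [Fin.removeNth, hp] using hi p)

theorem setIntegral_cube_indicator_Ioi {n : ℕ} {a b s : ℝ} (has : a ≤ s)
    (g : (Fin n → ℝ) → ℝ) :
    ∫ v in cube n a b, ((univ : Set (Fin n)).pi fun _ => Ioi s).indicator g v =
      ∫ v in cube n s b, g v := by
  have hset : cube n a b ∩ (univ : Set (Fin n)).pi (fun _ => Ioi s) =
      (univ : Set (Fin n)).pi fun _ => Ioc s b := by
    rw [cube, ← pi_inter_distrib]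
    congr! 2 with i
    rw [inter_comm, ← Ici_inter_Iic, ← inter_assoc, inter_eq_left.2 (Ioi_subset_Ici has),
      Ioi_inter_Iic]
  rw [setIntegral_indicator (MeasurableSet.univ_pi fun _ => measurableSet_Ioi), hset]
  exact setIntegral_congr_set Measure.pi_Ioc_ae_eq_pi_Icc

theorem setIntegral_indicator_minSet {n : ℕ} {F : (Fin (n + 1) → ℝ) → ℝ} (hF : Continuous F)
    (hperm : ∀ (σ : Equiv.Perm (Fin (n + 1))) v, F (v ∘ σ) = F v) (a b : ℝ) (j : Fin (n + 1)) :
    ∫ v in cube (n + 1) a b, (minSet j).indicator F v =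
      ∫ s in Icc a b, ∫ v in cube n s b, F (Fin.cons s v) := by
  let V : Set (ℝ × (Fin n → ℝ)) := {p | ∀ i, p.1 < p.2 i}
  let f : ℝ × (Fin n → ℝ) → ℝ := fun p => F (Fin.cons p.1 p.2)
  let e : (Fin (n + 1) → ℝ) → ℝ × (Fin n → ℝ) := fun v => (v j, j.removeNth v)
  have hV : MeasurableSet V := by
    rw [show V = ⋂ i, {p | p.1 < p.2 i} by ext; simp [V]]
    exact MeasurableSet.iInter fun i => measurableSet_lt (by fun_prop) (by fun_prop)
  have hf : Continuous f :=
    hF.comp (Continuous.finCons (A := fun _ => ℝ) continuous_fst continuous_snd)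
  have hfV : IntegrableOn (V.indicator f) (Icc a b ×ˢ cube n a b) :=
    (hf.continuousOn.integrableOn_compact (isCompact_Icc.prod (isCompact_cube n a b))).indicator hV
  have hFe : F = f ∘ e := by
    funext v
    simp only [f, e, Function.comp_apply, Fin.cons_removeNth_eq_comp_cycleRange_symm, hperm]
  have hind : (minSet j).indicator F = V.indicator f ∘ e := by
    funext v
    rw [hFe]
    exact indicator_comp_right (s := V) (g := f) e
  rw [hind]
  refine (setIntegral_cube_succAbove j hfV).trans
    (setIntegral_congr_fun measurableSet_Icc fun s hs => ?_)
  rw [← setIntegral_cube_indicator_Ioi hs.1]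
  simp [indicator, V, f]

theorem setIntegral_cube_symmetric {n : ℕ} {F : (Fin (n + 1) → ℝ) → ℝ} (hF : Continuous F)
    (hperm : ∀ (σ : Equiv.Perm (Fin (n + 1))) v, F (v ∘ σ) = F v) (a b : ℝ) :
    ∫ v in cube (n + 1) a b, F v =
      (n + 1) * ∫ s in Icc a b, ∫ v in cube n s b, F (Fin.cons s v) := by
  have hsum : ∀ᵐ v ∂volume.restrict (cube (n + 1) a b),
      F v = ∑ j, (minSet j).indicator F v := by
    filter_upwards [ae_restrict_of_ae (ae_injective (Fin (n + 1)))] with v hv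
    exact (sum_indicator_minSet F hv).symm
  rw [integral_congr_ae hsum, integral_finsetSum _ fun j _ =>
    (integrableOn_cube hF).indicator (measurableSet_minSet j)]
  simp [setIntegral_indicator_minSet hF hperm]

/-! ### Determinants of kernels -/

/-- The determinant of the matrix `k (vᵢ, wⱼ)`. -/
noncomputable def kernelDet (k : ℝ → ℝ → ℝ) {n : ℕ} (v w : Fin n → ℝ) : ℝ :=
  (Matrix.of fun i j => k (v i) (w j)).det

theorem continuous_kernelDet {k : ℝ → ℝ → ℝ} (hk : Continuous (Function.uncurry k)) {n : ℕ}
    {Y : Type*} [TopologicalSpace Y] {v w : Y → Fin n → ℝ} (hv : Continuous v)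
    (hw : Continuous w) : Continuous fun y => kernelDet k (v y) (w y) := by
  refine Continuous.matrix_det (continuous_matrix fun i j => ?_)
  exact hk.comp (((continuous_apply i).comp hv).prodMk ((continuous_apply j).comp hw))

theorem continuous_kernelDet_cons {k : ℝ → ℝ → ℝ} (hk : Continuous (Function.uncurry k)) {n : ℕ}
    {Y : Type*} [TopologicalSpace Y] {x y : Y → ℝ} {v w : Y → Fin n → ℝ} (hx : Continuous x)
    (hv : Continuous v) (hy : Continuous y) (hw : Continuous w) :
    Continuous fun t => kernelDet k (Fin.cons (x t) (v t)) (Fin.cons (y t) (w t)) :=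
  continuous_kernelDet hk (Continuous.finCons (A := fun _ => ℝ) hx hv)
    (Continuous.finCons (A := fun _ => ℝ) hy hw)

section

variable (k : ℝ → ℝ → ℝ) {n : ℕ}

theorem kernelDet_comp_perm_left (σ : Equiv.Perm (Fin n)) (v w : Fin n → ℝ) :
    kernelDet k (v ∘ σ) w = (Equiv.Perm.sign σ : ℤ) * kernelDet k v w :=
  Matrix.det_permute σ (Matrix.of fun i j => k (v i) (w j))

theorem kernelDet_comp_perm (σ : Equiv.Perm (Fin n)) (v w : Fin n → ℝ) :
    kernelDet k (v ∘ σ) (w ∘ σ) = kernelDet k v w :=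
  Matrix.det_submatrix_equiv_self σ (Matrix.of fun i j => k (v i) (w j))

theorem kernelDet_cons_removeNth (j : Fin (n + 1)) (v w : Fin (n + 1) → ℝ) :
    kernelDet k (Fin.cons (v j) (j.removeNth v)) w = (-1) ^ (j : ℕ) * kernelDet k v w := by
  rw [Fin.cons_removeNth_eq_comp_cycleRange_symm, kernelDet_comp_perm_left, Equiv.Perm.sign_symm,
    Fin.sign_cycleRange]
  push_cast
  rfl

theorem kernelDet_cons_left (x : ℝ) (v : Fin n → ℝ) (w : Fin (n + 1) → ℝ) :
    kernelDet k (Fin.cons x v) w =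
      ∑ j : Fin (n + 1), (-1) ^ (j : ℕ) * k x (w j) * kernelDet k v (j.removeNth w) := by
  rw [kernelDet, Matrix.det_succ_row_zero]
  rfl

theorem removeNth_succ_cons (x : ℝ) (v : Fin (n + 1) → ℝ) (j : Fin (n + 1)) :
    j.succ.removeNth (Fin.cons x v : Fin (n + 2) → ℝ) = Fin.cons x (j.removeNth v) := by
  funext i
  cases i using Fin.cases <;> simp [Fin.removeNth]

theorem kernelDet_cons_cons (x y : ℝ) (v : Fin (n + 1) → ℝ) :
    kernelDet k (Fin.cons x v) (Fin.cons y v) = k x y * kernelDet k v v -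
      ∑ j, k x (v j) *
        kernelDet k (Fin.cons (v j) (j.removeNth v)) (Fin.cons y (j.removeNth v)) := by
  rw [kernelDet_cons_left, Fin.sum_univ_succ, sub_eq_add_neg, ← Finset.sum_neg_distrib]
  congr 1
  · simp [Fin.removeNth_zero]
  · refine Finset.sum_congr rfl fun j _ => ?_
    rw [kernelDet_cons_removeNth, removeNth_succ_cons, Fin.cons_succ, Fin.val_succ, pow_succ]
    ring

end

theorem abs_det_le_prod_norm {n : ℕ} (M : Matrix (Fin n) (Fin n) ℝ) :
    |M.det| ≤ ∏ i, ‖WithLp.toLp 2 (M i)‖ := by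
  have : Fact (Module.finrank ℝ (EuclideanSpace ℝ (Fin n)) = n) := ⟨by simp⟩
  let e := EuclideanSpace.basisFun (Fin n) ℝ
  have h := e.toBasis.orientation.abs_volumeForm_apply_le fun i => WithLp.toLp 2 (M i)
  rw [e.toBasis.orientation.volumeForm_robust e rfl, Module.Basis.det_apply] at h
  rw [← Matrix.det_transpose]
  convert h using 3
  ext i j
  simp [e, Module.Basis.toMatrix_apply]

theorem norm_toLp_le {n : ℕ} {B : ℝ} (hB : 0 ≤ B) {u : Fin n → ℝ} (hu : ∀ i, |u i| ≤ B) :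
    ‖WithLp.toLp 2 u‖ ≤ B * √n := by
  rw [EuclideanSpace.norm_eq]
  refine Real.sqrt_le_iff.2 ⟨by positivity, ?_⟩
  calc ∑ i, ‖u i‖ ^ 2 ≤ ∑ _i : Fin n, B ^ 2 :=
        Finset.sum_le_sum fun i _ => pow_le_pow_left₀ (norm_nonneg _) (hu i) 2
    _ = (B * √n) ^ 2 := by
        rw [mul_pow, Real.sq_sqrt n.cast_nonneg]
        simp [mul_comm]

theorem abs_kernelDet_le {k : ℝ → ℝ → ℝ} {B : ℝ} (hB : ∀ x y, |k x y| ≤ B) {n : ℕ}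
    (v w : Fin n → ℝ) : |kernelDet k v w| ≤ (B * √n) ^ n :=
  calc |kernelDet k v w| ≤ ∏ i, ‖WithLp.toLp 2 fun j => k (v i) (w j)‖ := abs_det_le_prod_norm _
    _ ≤ ∏ _i : Fin n, B * √n := Finset.prod_le_prod (fun _ _ => norm_nonneg _) fun _ _ =>
        norm_toLp_le ((abs_nonneg _).trans (hB 0 0)) fun _ => hB _ _
    _ = (B * √n) ^ n := by simp

/-- Hadamard's bound for the `n`-th term of the series of Fredholm's first minor, for a kernel
bounded by `B` on an interval of length `L`. -/
noncomputable def hadamardBound (B L : ℝ) (n : ℕ) : ℝ :=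
  (B * √(n + 1 : ℕ)) ^ (n + 1) * L ^ n / n.factorial

theorem hadamardBound_mono {B L L' : ℝ} (hB : 0 ≤ B) (hL : 0 ≤ L) (h : L ≤ L') (n : ℕ) :
    hadamardBound B L n ≤ hadamardBound B L' n := by
  rw [hadamardBound, hadamardBound]
  gcongr

theorem hadamardBound_sq_le (B L : ℝ) (n : ℕ) : hadamardBound B L n ^ 2 ≤
    Real.exp 1 * B ^ 2 * ((2 * Real.exp 1 * B ^ 2 * L ^ 2) ^ n / n.factorial) := by
  have hpow : ((n + 1 : ℕ) : ℝ) ^ n ≤ Real.exp 1 ^ (n + 1) * n.factorial := by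
    have := Real.pow_div_factorial_le_exp ((n + 1 : ℕ) : ℝ) (by positivity) n
    rw [div_le_iff₀ (by positivity)] at this
    rwa [← Real.exp_nat_mul, mul_one]
  have hlin : ((n + 1 : ℕ) : ℝ) ≤ 2 ^ n := by exact_mod_cast Nat.lt_two_pow_self
  have hsqrt : √(n + 1 : ℕ) ^ 2 = ((n + 1 : ℕ) : ℝ) := Real.sq_sqrt (by positivity)
  calc hadamardBound B L n ^ 2
      = B ^ 2 * (B ^ 2 * L ^ 2) ^ n * (√(n + 1 : ℕ) ^ 2 * (√(n + 1 : ℕ) ^ 2) ^ n) /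
          (n.factorial : ℝ) ^ 2 := by
        rw [hadamardBound]
        ring
    _ ≤ B ^ 2 * (B ^ 2 * L ^ 2) ^ n * (2 ^ n * (Real.exp 1 ^ (n + 1) * n.factorial)) /
          (n.factorial : ℝ) ^ 2 := by
        rw [hsqrt]
        gcongr
    _ = Real.exp 1 * B ^ 2 * ((2 * Real.exp 1 * B ^ 2 * L ^ 2) ^ n / n.factorial) := by
        field_simp
        ring

theorem summable_of_summable_four_pow_mul_sq {c : ℕ → ℝ} (h : Summable fun n => 4 ^ n * c n ^ 2) :
    Summable c := by
  refine Summable.of_norm_bounded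
    (h.add (summable_geometric_of_lt_one (r := 1 / 4) (by norm_num) (by norm_num))) fun n => ?_
  have hmul : (2 : ℝ) ^ n * |c n| * (1 / 2) ^ n = |c n| := by
    rw [mul_right_comm, ← mul_pow]
    norm_num
  have hsq : (2 : ℝ) ^ n * |c n| * (1 / 2) ^ n ≤ (2 ^ n * |c n|) ^ 2 + ((1 / 2) ^ n) ^ 2 := by
    nlinarith [two_mul_le_add_sq ((2 : ℝ) ^ n * |c n|) ((1 / 2) ^ n),
      sq_nonneg ((2 : ℝ) ^ n * |c n|), sq_nonneg ((1 / 2 : ℝ) ^ n)]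
  calc ‖c n‖ ≤ (2 ^ n * |c n|) ^ 2 + ((1 / 2) ^ n) ^ 2 := hmul.symm.trans_le hsq
    _ = 4 ^ n * c n ^ 2 + (1 / 4) ^ n := by
        rw [mul_pow, sq_abs, ← pow_mul, ← pow_mul, mul_comm n, pow_mul, pow_mul]
        norm_num

theorem summable_hadamardBound (B L : ℝ) : Summable (hadamardBound B L) := by
  refine summable_of_summable_four_pow_mul_sq (Summable.of_nonneg_of_le (fun n => by positivity)
    (fun n => ?_) ((Real.summable_pow_div_factorial (8 * Real.exp 1 * B ^ 2 * L ^ 2)).mul_left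
      (Real.exp 1 * B ^ 2)))
  calc 4 ^ n * hadamardBound B L n ^ 2
      ≤ 4 ^ n * (Real.exp 1 * B ^ 2 * ((2 * Real.exp 1 * B ^ 2 * L ^ 2) ^ n / n.factorial)) := by
        gcongr
        exact hadamardBound_sq_le B L n
    _ = Real.exp 1 * B ^ 2 * ((4 * (2 * Real.exp 1 * B ^ 2 * L ^ 2)) ^ n / n.factorial) := by
        rw [mul_pow 4]
        ring
    _ = Real.exp 1 * B ^ 2 * ((8 * Real.exp 1 * B ^ 2 * L ^ 2) ^ n / n.factorial) := by
        ring_nf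

/-! ### Fredholm's series -/

/-- The `n`-th term of Fredholm's series for the determinant of `1 - K`, where `K` is the integral
operator with kernel `k` on `[a, b]`. -/
noncomputable def detTerm (k : ℝ → ℝ → ℝ) (a b : ℝ) (n : ℕ) : ℝ :=
  (-1) ^ n / (n.factorial : ℝ) * ∫ v in cube n a b, kernelDet k v v

/-- The `n`-th term of Fredholm's series for the first minor of `1 - K`. -/
noncomputable def minorTerm (k : ℝ → ℝ → ℝ) (a b : ℝ) (n : ℕ) (x y : ℝ) : ℝ :=
  (-1) ^ n / (n.factorial : ℝ) * ∫ v in cube n a b, kernelDet k (Fin.cons x v) (Fin.cons y v)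

/-- Fredholm's first minor of `1 - K`, which is `det (1 - K)` times the resolvent kernel of `K`. -/
noncomputable def fredholmMinor (k : ℝ → ℝ → ℝ) (a b x y : ℝ) : ℝ := ∑' n, minorTerm k a b n x y

theorem fredholmDet_one (k : ℝ → ℝ → ℝ) (a b : ℝ) :
    fredholmDet a b k 1 = ∑' n, detTerm k a b n := rfl

theorem detTerm_zero (k : ℝ → ℝ → ℝ) (a b : ℝ) : detTerm k a b 0 = 1 := by
  rw [detTerm, setIntegral_cube_zero]
  simp [kernelDet]

theorem minorTerm_zero (k : ℝ → ℝ → ℝ) (a b x y : ℝ) : minorTerm k a b 0 x y = k x y := by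
  rw [minorTerm, setIntegral_cube_zero]
  simp [kernelDet]

theorem detTerm_affine (k : ℝ → ℝ → ℝ) {m : ℝ} (hm : 0 ≤ m) (a b c : ℝ) (n : ℕ) :
    detTerm k (c + m * a) (c + m * b) n =
      detTerm (fun x y => m * k (c + m * x) (c + m * y)) a b n := by
  have hdet : ∀ v : Fin n → ℝ, kernelDet (fun x y => m * k (c + m * x) (c + m * y)) v v =
      m ^ n * kernelDet k (fun i => c + m * v i) fun i => c + m * v i := fun v => by
    refine (Matrix.det_smul (Matrix.of fun i j => k (c + m * v i) (c + m * v j)) m).trans ?_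
    rw [Fintype.card_fin, kernelDet]
  rw [detTerm, detTerm, setIntegral_cube_affine hm]
  simp only [hdet, integral_const_mul]

theorem fredholmMinor_translate (k : ℝ → ℝ → ℝ) (a b c x y : ℝ) :
    fredholmMinor k (c + a) (c + b) (c + x) (c + y) =
      fredholmMinor (fun x y => k (c + x) (c + y)) a b x y := by
  refine tsum_congr fun n => ?_
  have hcons : ∀ x (v : Fin n → ℝ), (Fin.cons (c + x) fun i => c + v i : Fin (n + 1) → ℝ) =
      fun i => c + (Fin.cons x v : Fin (n + 1) → ℝ) i := fun x v =>
    (Fin.comp_cons (fun s => c + s) x v).symm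
  have hcube := setIntegral_cube_affine zero_le_one a b c fun v : Fin n → ℝ =>
    kernelDet k (Fin.cons (c + x) v) (Fin.cons (c + y) v)
  simp only [one_mul, one_pow, hcons] at hcube
  rw [minorTerm, hcube]
  rfl

section

variable {k : ℝ → ℝ → ℝ} {B : ℝ}

theorem abs_minorTerm_le (hB : ∀ x y, |k x y| ≤ B) {a b : ℝ} (hab : a ≤ b) (n : ℕ) (x y : ℝ) :
    |minorTerm k a b n x y| ≤ hadamardBound B (b - a) n := by
  rw [minorTerm, abs_mul, hadamardBound, abs_div, abs_pow, abs_neg, abs_one, one_pow, Nat.abs_cast,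
    one_div_mul_eq_div]
  gcongr
  exact abs_setIntegral_cube_le hab fun v => abs_kernelDet_le hB _ _

theorem hasSum_minorTerm (hB : ∀ x y, |k x y| ≤ B) {a b : ℝ} (hab : a ≤ b) (x y : ℝ) :
    HasSum (fun n => minorTerm k a b n x y) (fredholmMinor k a b x y) :=
  (Summable.of_norm_bounded (summable_hadamardBound B (b - a)) fun n =>
    abs_minorTerm_le hB hab n x y).hasSum

theorem continuousOn_minorTerm (hk : Continuous (Function.uncurry k)) {a b x y : ℝ → ℝ}
    (ha : Continuous a) (hb : Continuous b) (hx : Continuous x) (hy : Continuous y) (n : ℕ) :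
    ContinuousOn (fun t => minorTerm k (a t) (b t) n (x t) (y t)) {t | a t ≤ b t} := by
  have hunit : Continuous fun t => ∫ v in cube n 0 1,
      kernelDet k (Fin.cons (x t) fun i => a t + (b t - a t) * v i)
        (Fin.cons (y t) fun i => a t + (b t - a t) * v i) := by
    refine continuous_parametric_integral_of_continuous ?_ (isCompact_cube n 0 1)
    exact continuous_kernelDet_cons hk (by fun_prop) (by fun_prop) (by fun_prop) (by fun_prop)
  refine continuousOn_const.mul ((((hb.sub ha).pow n).mul hunit).continuousOn.congr fun t ht => ?_)
  have hcube := setIntegral_cube_affine (sub_nonneg.2 ht) 0 1 (a t) fun v : Fin n → ℝ =>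
    kernelDet k (Fin.cons (x t) v) (Fin.cons (y t) v)
  rw [mul_zero, add_zero, mul_one, add_sub_cancel] at hcube
  exact hcube

theorem continuousOn_fredholmMinor (hk : Continuous (Function.uncurry k))
    (hB : ∀ x y, |k x y| ≤ B) {a b x y : ℝ → ℝ}
    (ha : Continuous a) (hb : Continuous b) (hx : Continuous x) (hy : Continuous y) (L : ℝ) :
    ContinuousOn (fun t => fredholmMinor k (a t) (b t) (x t) (y t))
      {t | a t ≤ b t ∧ b t - a t ≤ L} := by
  refine continuousOn_tsum
    (fun n => (continuousOn_minorTerm hk ha hb hx hy n).mono fun t ht => ht.1)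
    (summable_hadamardBound B L) fun n t ht => (abs_minorTerm_le hB ht.1 n _ _).trans ?_
  exact hadamardBound_mono ((abs_nonneg _).trans (hB 0 0)) (sub_nonneg.2 ht.1) ht.2 n

theorem detTerm_succ (hk : Continuous (Function.uncurry k)) {a b : ℝ} (hab : a ≤ b) (n : ℕ) :
    detTerm k a b (n + 1) = -∫ s in a..b, minorTerm k s b n s s := by
  have hdet : Continuous fun v : Fin (n + 1) → ℝ => kernelDet k v v :=
    continuous_kernelDet hk continuous_id continuous_id
  rw [detTerm, setIntegral_cube_symmetric hdet fun σ v => kernelDet_comp_perm k σ v v,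
    intervalIntegral.integral_of_le hab,
    ← integral_Icc_eq_integral_Ioc]
  simp only [minorTerm, integral_const_mul, Nat.factorial_succ]
  push_cast
  field_simp
  ring

theorem hasSum_detTerm (hk : Continuous (Function.uncurry k)) (hB : ∀ x y, |k x y| ≤ B) {a b : ℝ}
    (hab : a ≤ b) :
    HasSum (detTerm k a b) (1 - ∫ s in a..b, fredholmMinor k s b s s) := by
  have hle : ∀ s ∈ uIoc a b, s ≤ b := fun s hs => (uIoc_of_le hab ▸ hs).2
  have hint : HasSum (fun n => ∫ s in a..b, minorTerm k s b n s s)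
      (∫ s in a..b, fredholmMinor k s b s s) := by
    refine intervalIntegral.hasSum_integral_of_dominated_convergence
      (fun n _ => hadamardBound B (b - a) n) (fun n => ?_) (fun n => ?_)
      (Eventually.of_forall fun s _ => summable_hadamardBound B (b - a)) intervalIntegrable_const
      (Eventually.of_forall fun s hs => hasSum_minorTerm hB (hle s hs) s s)
    · exact ((continuousOn_minorTerm hk continuous_id continuous_const continuous_id continuous_id
        n).mono hle).aestronglyMeasurable measurableSet_uIoc
    · refine Eventually.of_forall fun s hs => (abs_minorTerm_le hB (hle s hs) n s s).trans ?_
      exact hadamardBound_mono ((abs_nonneg _).trans (hB 0 0)) (sub_nonneg.2 (hle s hs))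
        (sub_le_sub_left (uIoc_of_le hab ▸ hs).1.le b) n
  have hzero : HasSum (fun n => detTerm k a b (n + 1)) (-∫ s in a..b, fredholmMinor k s b s s) := by
    simpa only [detTerm_succ hk hab] using hint.neg
  simpa [detTerm_zero, sub_eq_add_neg] using hzero.zero_add

theorem fredholmDet_one_eq_one_sub (hk : Continuous (Function.uncurry k))
    (hB : ∀ x y, |k x y| ≤ B) {a b : ℝ} (hab : a ≤ b) :
    fredholmDet a b k 1 = 1 - ∫ s in a..b, fredholmMinor k s b s s :=
  (hasSum_detTerm hk hB hab).tsum_eq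

theorem setIntegral_kernelDet_cons_cons (hk : Continuous (Function.uncurry k)) {a b : ℝ}
    (hab : a ≤ b) (n : ℕ) (x y : ℝ) :
    ∫ v in cube (n + 1) a b, kernelDet k (Fin.cons x v) (Fin.cons y v) =
      k x y * (∫ v in cube (n + 1) a b, kernelDet k v v) -
        (n + 1) * ∫ s in a..b, k x s *
          ∫ v in cube n a b, kernelDet k (Fin.cons s v) (Fin.cons y v) := by
  have hdet : Continuous fun v : Fin (n + 1) → ℝ => kernelDet k v v :=
    continuous_kernelDet hk continuous_id continuous_id
  let g : ℝ × (Fin n → ℝ) → ℝ := fun p =>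
    k x p.1 * kernelDet k (Fin.cons p.1 p.2) (Fin.cons y p.2)
  have hg : Continuous g := (hk.comp (continuous_const.prodMk continuous_fst)).mul
    (continuous_kernelDet_cons hk continuous_fst continuous_snd continuous_const continuous_snd)
  have hterm : ∀ j : Fin (n + 1), IntegrableOn (fun v => g (v j, j.removeNth v))
      (cube (n + 1) a b) := fun j =>
    integrableOn_cube (hg.comp (by unfold Fin.removeNth; fun_prop))
  simp only [kernelDet_cons_cons]
  rw [integral_sub ((integrableOn_cube hdet).const_mul _)
    (integrable_finsetSum _ fun j _ => hterm j), integral_const_mul,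
    integral_finsetSum _ fun j _ => hterm j, Finset.sum_congr rfl fun j _ =>
      setIntegral_cube_succAbove j (hg.continuousOn.integrableOn_compact
        (isCompact_Icc.prod (isCompact_cube n a b))),
    intervalIntegral.integral_of_le hab, ← integral_Icc_eq_integral_Ioc]
  simp [g, integral_const_mul]

theorem minorTerm_succ (hk : Continuous (Function.uncurry k)) {a b : ℝ} (hab : a ≤ b) (n : ℕ)
    (x y : ℝ) :
    minorTerm k a b (n + 1) x y =
      k x y * detTerm k a b (n + 1) + ∫ s in a..b, k x s * minorTerm k a b n s y := by
  simp only [minorTerm, detTerm, setIntegral_kernelDet_cons_cons hk hab, mul_left_comm (k x _),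
    intervalIntegral.integral_const_mul, Nat.factorial_succ]
  push_cast
  field_simp
  ring

theorem continuous_fredholmMinor_left (hk : Continuous (Function.uncurry k))
    (hB : ∀ x y, |k x y| ≤ B) {a b : ℝ} (hab : a ≤ b) (y : ℝ) :
    Continuous fun x => fredholmMinor k a b x y := by
  have h := continuousOn_fredholmMinor hk hB (a := fun _ => a) (b := fun _ => b)
    continuous_const continuous_const continuous_id (continuous_const (y := y)) (b - a)
  simpa [hab, continuousOn_univ] using h

theorem fredholmMinor_eq (hk : Continuous (Function.uncurry k)) (hB : ∀ x y, |k x y| ≤ B)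
    {a b : ℝ} (hab : a ≤ b) (x y : ℝ) :
    fredholmMinor k a b x y =
      fredholmDet a b k 1 * k x y + ∫ s in a..b, k x s * fredholmMinor k a b s y := by
  have hint : HasSum (fun n => ∫ s in a..b, k x s * minorTerm k a b n s y)
      (∫ s in a..b, k x s * fredholmMinor k a b s y) := by
    refine intervalIntegral.hasSum_integral_of_dominated_convergence
      (fun n _ => B * hadamardBound B (b - a) n) (fun n => ?_) (fun n => ?_)
      (Eventually.of_forall fun s _ => (summable_hadamardBound B (b - a)).mul_left B)
      intervalIntegrable_const
      (Eventually.of_forall fun s _ => (hasSum_minorTerm hB hab s y).mul_left _)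
    · have hterm := continuousOn_minorTerm hk (a := fun _ => a) (b := fun _ => b)
        continuous_const continuous_const continuous_id (continuous_const (y := y)) n
      simp only [hab, ofPred_true, continuousOn_univ] at hterm
      exact ((hk.comp (by fun_prop : Continuous fun s => (x, s))).mul hterm).aestronglyMeasurable
    · refine Eventually.of_forall fun s _ => (norm_mul _ _).trans_le ?_
      exact mul_le_mul (hB x s) (abs_minorTerm_le hB hab n s y) (norm_nonneg _)
        ((abs_nonneg _).trans (hB 0 0))
  have hdet := (hasSum_nat_add_iff' 1).2 (hasSum_detTerm hk hB hab)
  have hminor := (hasSum_nat_add_iff' 1).2 (hasSum_minorTerm hB hab x y)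
  simp only [minorTerm_succ hk hab, Finset.sum_range_one, minorTerm_zero, detTerm_zero]
    at hdet hminor
  have := hminor.unique ((hdet.mul_left (k x y)).add hint)
  rw [← fredholmDet_one_eq_one_sub hk hB hab] at this
  linarith

theorem fredholmDet_neg_self_eq (hk : Continuous (Function.uncurry k)) (hB : ∀ x y, |k x y| ≤ B)
    (htrans : ∀ c x y, k (c + x) (c + y) = k x y) {z : ℝ} (hz : 0 ≤ z) :
    fredholmDet (-z) z k 1 = 1 - 2 * ∫ t in 0..z, fredholmMinor k (-t) t (-t) (-t) := by
  have hminor : ∀ s, fredholmMinor k s z s s =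
      fredholmMinor k (-((z - s) / 2)) ((z - s) / 2) (-((z - s) / 2)) (-((z - s) / 2)) := by
    intro s
    have h := fredholmMinor_translate k (-((z - s) / 2)) ((z - s) / 2) ((z + s) / 2)
      (-((z - s) / 2)) (-((z - s) / 2))
    simp only [htrans] at h
    rw [← h]
    ring_nf
  have hsub := intervalIntegral.integral_comp_sub_div
    (fun t => fredholmMinor k (-t) t (-t) (-t)) (two_ne_zero (α := ℝ)) (z / 2)
    (a := -z) (b := z)
  rw [fredholmDet_one_eq_one_sub hk hB (neg_le_self hz)]
  simp only [hminor, sub_div]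
  rw [hsub, smul_eq_mul]
  ring_nf

end

theorem fredholmDet_affine (k : ℝ → ℝ → ℝ) {m : ℝ} (hm : 0 ≤ m) (a b c : ℝ) :
    fredholmDet (c + m * a) (c + m * b) k 1 =
      fredholmDet a b (fun x y => m * k (c + m * x) (c + m * y)) 1 := by
  simp only [fredholmDet_one, detTerm_affine k hm]

/-! ### The resolvent kernel on `[-z, z]` -/

/-- The kernel `sin π(x - y) / (π(x - y))`, which becomes `sineKernel z` when `[-z, z]` is rescaled
to `[-1, 1]`. -/
noncomputable def unitSine (x y : ℝ) : ℝ := Real.sinc (Real.pi * (x - y))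

theorem continuous_unitSine : Continuous (Function.uncurry unitSine) :=
  Real.continuous_sinc.comp (by fun_prop)

theorem abs_unitSine_le (x y : ℝ) : |unitSine x y| ≤ 1 := Real.abs_sinc_le_one _

theorem unitSine_comm (x y : ℝ) : unitSine x y = unitSine y x := by
  rw [unitSine, unitSine, ← Real.sinc_neg, ← mul_neg, neg_sub]

theorem unitSine_add_add (c x y : ℝ) : unitSine (c + x) (c + y) = unitSine x y := by
  rw [unitSine, unitSine, add_sub_add_left_eq_sub]

theorem sineKernel_eq (z x y : ℝ) : sineKernel z x y = z * unitSine (z * x) (z * y) := by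
  rw [sineKernel, unitSine, ← mul_sub, mul_left_comm, mul_assoc]

theorem integral_eq_smul_integral_𝕁 {F : Type*} [NormedAddCommGroup F] [NormedSpace ℝ F] (z : ℝ)
    (f : ℝ → F) : ∫ s in (-z)..z, f s = z • ∫ t : 𝕁, f (z * t) := by
  rw [integral_𝕁 fun t => f (z * t), intervalIntegral.smul_integral_comp_mul_left, mul_neg, mul_one]

theorem exists_mul_eq {z x : ℝ} (hz : 0 < z) (hx : x ∈ Icc (-z) z) : ∃ t : 𝕁, z * t = x := by
  refine ⟨⟨x / z, ?_, ?_⟩, mul_div_cancel₀ x hz.ne'⟩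
  · rw [le_div_iff₀ hz, neg_one_mul]
    exact hx.1
  · rw [div_le_one₀ hz]
    exact hx.2

/-- The function `t ↦ g (z t)` on `[-1, 1]`. -/
def rescale (z : ℝ) (g : C(ℝ, ℝ)) : C(𝕁, ℝ) := g.comp ⟨fun t => z * t, by fun_prop⟩

theorem rescale_apply (z : ℝ) (g : C(ℝ, ℝ)) (t : 𝕁) : rescale z g t = g (z * t) := rfl

theorem sineOperator_rescale (z : ℝ) (g : C(ℝ, ℝ)) (x : 𝕁) :
    sineOperator z (rescale z g) x = ∫ s in (-z)..z, unitSine (z * x) s * g s := by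
  have h := apply_gramOperator_eq pairing waves z (rescale z g) (ContinuousMap.evalCLM ℝ x)
  rw [ContinuousMap.evalCLM_apply, pairing_apply] at h
  rw [h, integral_eq_smul_integral_𝕁, smul_eq_mul, ← integral_const_mul]
  simp only [gramVector_waves_apply, rescale_apply, sineKernel_eq, mul_assoc]

/-- The section at `y` of the resolvent kernel of `sineOperator z`. -/
noncomputable abbrev resolventSection (z : ℝ) (y : 𝕁) : C(𝕁, ℝ) :=
  resolventVector pairing waves z (ContinuousMap.evalCLM ℝ y)

theorem resolventSection_comm (z : ℝ) (x y : 𝕁) : resolventSection z y x = resolventSection z x y :=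
  resolventVector_comm pairing_comm (isUnit_one_sub_sineOperator z) (ContinuousMap.evalCLM ℝ y)
    (ContinuousMap.evalCLM ℝ x)

theorem continuous_resolventSection (z : ℝ) : Continuous (resolventSection z) := by
  have hk : Continuous fun p : 𝕁 × 𝕁 => sineKernel z p.1 p.2 := by
    have := continuous_unitSine
    simp only [sineKernel_eq]
    fun_prop
  have hcurry : (fun y => gramVector waves z (ContinuousMap.evalCLM ℝ y)) =
      ContinuousMap.curry ⟨_, hk⟩ := by
    ext y x
    exact gramVector_waves_apply z y x
  exact (ContinuousLinearMap.continuous _).comp (hcurry ▸ ContinuousMap.continuous _)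

/-- The resolvent kernel of `unitSine` on `[-z, z]`, extended to the plane by the projection to the
square. -/
noncomputable def sineResolventKernel (z x y : ℝ) : ℝ :=
  z⁻¹ * resolventSection z (projIcc (-1) 1 (by norm_num) (y / z))
    (projIcc (-1) 1 (by norm_num) (x / z))

theorem continuous_sineResolventKernel (z : ℝ) :
    Continuous (Function.uncurry (sineResolventKernel z)) := by
  have hproj : Continuous (projIcc (-1 : ℝ) 1 (by norm_num)) := continuous_projIcc
  exact continuous_const.mul (ContinuousEval.continuous_eval.comp
    (((continuous_resolventSection z).comp (hproj.comp (by fun_prop))).prodMk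
      (hproj.comp (by fun_prop))))

theorem sineResolventKernel_comm (z x y : ℝ) :
    sineResolventKernel z x y = sineResolventKernel z y x := by
  rw [sineResolventKernel, resolventSection_comm, sineResolventKernel]

theorem sineResolventKernel_mul_mul {z : ℝ} (hz : z ≠ 0) (x y : 𝕁) :
    sineResolventKernel z (z * x) (z * y) = z⁻¹ * resolventSection z y x := by
  simp only [sineResolventKernel, mul_div_cancel_left₀ _ hz, projIcc_val]

theorem inverse_one_sub_sineOperator_rescale {z : ℝ} (hz : z ≠ 0) (g : C(ℝ, ℝ)) (x : 𝕁) :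
    Ring.inverse (1 - sineOperator z) (rescale z g) x =
      g (z * x) + ∫ s in (-z)..z, sineResolventKernel z (z * x) s * g s := by
  have h := apply_inverse_one_sub pairing_comm (isUnit_one_sub_sineOperator z) (rescale z g)
    (ContinuousMap.evalCLM ℝ x)
  rw [ContinuousMap.evalCLM_apply, ContinuousMap.evalCLM_apply, pairing_apply] at h
  rw [h, integral_eq_smul_integral_𝕁, smul_eq_mul, ← integral_const_mul]
  simp only [sineResolventKernel_mul_mul hz, resolventSection_comm z x, rescale_apply, ← mul_assoc,
    mul_inv_cancel₀ hz, one_mul]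

/-- The section `unitSine · y` of the kernel. -/
noncomputable def unitSineSection (y : ℝ) : C(ℝ, ℝ) :=
  ⟨fun x => unitSine x y, continuous_unitSine.uncurry_right y⟩

theorem unitSineSection_apply (x y : ℝ) : unitSineSection y x = unitSine x y := rfl

theorem inverse_one_sub_sineOperator_unitSineSection {z : ℝ} (hz : z ≠ 0) (x y : 𝕁) :
    Ring.inverse (1 - sineOperator z) (rescale z (unitSineSection (z * y))) x =
      sineResolventKernel z (z * x) (z * y) := by
  have hgram : rescale z (unitSineSection (z * y)) =
      z⁻¹ • gramVector waves z (ContinuousMap.evalCLM ℝ y) := by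
    ext t
    rw [rescale_apply, unitSineSection_apply, ContinuousMap.smul_apply, gramVector_waves_apply,
      sineKernel_eq, smul_eq_mul, inv_mul_cancel_left₀ hz, unitSine_comm]
  rw [hgram, map_smul, sineResolventKernel_mul_mul hz]
  rfl

theorem sineResolventKernel_eq_mul_unitSine {z x y : ℝ} (hz : 0 < z) (hx : x ∈ Icc (-z) z)
    (hy : y ∈ Icc (-z) z) : sineResolventKernel z x y =
      unitSine x y + ∫ s in (-z)..z, sineResolventKernel z x s * unitSine s y := by
  obtain ⟨x, rfl⟩ := exists_mul_eq hz hx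
  obtain ⟨y, rfl⟩ := exists_mul_eq hz hy
  rw [← inverse_one_sub_sineOperator_unitSineSection hz.ne',
    inverse_one_sub_sineOperator_rescale hz.ne']
  rfl

theorem sineResolventKernel_eq_unitSine_mul {z x y : ℝ} (hz : 0 < z) (hx : x ∈ Icc (-z) z)
    (hy : y ∈ Icc (-z) z) : sineResolventKernel z x y =
      unitSine x y + ∫ s in (-z)..z, unitSine x s * sineResolventKernel z s y := by
  rw [sineResolventKernel_comm, sineResolventKernel_eq_mul_unitSine hz hy hx]
  simp only [unitSine_comm _ x, sineResolventKernel_comm z y, mul_comm]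

theorem fredholmMinor_unitSine {z x y : ℝ} (hz : 0 < z) (hx : x ∈ Icc (-z) z)
    (hy : y ∈ Icc (-z) z) : fredholmMinor unitSine (-z) z x y =
      fredholmDet (-z) z unitSine 1 * sineResolventKernel z x y := by
  obtain ⟨x, rfl⟩ := exists_mul_eq hz hx
  obtain ⟨y, rfl⟩ := exists_mul_eq hz hy
  have hzz : -z ≤ z := by linarith
  let M : C(ℝ, ℝ) := ⟨fun t => fredholmMinor unitSine (-z) z t (z * y),
    continuous_fredholmMinor_left continuous_unitSine abs_unitSine_le hzz _⟩
  have hM : (1 - sineOperator z) (rescale z M) =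
      fredholmDet (-z) z unitSine 1 • rescale z (unitSineSection (z * y)) := by
    ext t
    change rescale z M t - sineOperator z (rescale z M) t = _
    rw [sub_eq_iff_eq_add, sineOperator_rescale]
    exact fredholmMinor_eq continuous_unitSine abs_unitSine_le hzz (z * t) (z * y)
  have hinv := DFunLike.congr_fun (Ring.inverse_mul_cancel _ (isUnit_one_sub_sineOperator z))
    (rescale z M)
  rw [mul_apply_eq_comp, hM, map_smul] at hinv
  rw [← inverse_one_sub_sineOperator_unitSineSection hz.ne']
  exact (DFunLike.congr_fun hinv x).symm

/-! ### Integral operators on `[-z, z]` -/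

section IntOp

variable {z x : ℝ} {k : ℝ → ℝ → ℂ} {f g : ℝ → ℂ}

theorem intOp_congr_ae (k : ℝ → ℝ → ℂ) (h : f =ᵐ[volume.restrict (Icc (-z) z)] g) (hz : 0 ≤ z)
    (x : ℝ) : intOp z k f x = intOp z k g x := by
  refine intervalIntegral.integral_congr_ae_restrict ?_
  rw [uIoc_of_le (by linarith)]
  filter_upwards [ae_restrict_of_ae_restrict_of_subset Ioc_subset_Icc_self h] with y hy
  rw [hy]

theorem intOp_add (hk : Continuous (k x)) (hf : IntervalIntegrable f volume (-z) z)
    (hg : IntervalIntegrable g volume (-z) z) :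
    intOp z k (fun y => f y + g y) x = intOp z k f x + intOp z k g x := by
  simp only [intOp, mul_add]
  exact intervalIntegral.integral_add (hf.continuousOn_mul hk.continuousOn)
    (hg.continuousOn_mul hk.continuousOn)

theorem intOp_sub (hk : Continuous (k x)) (hf : IntervalIntegrable f volume (-z) z)
    (hg : IntervalIntegrable g volume (-z) z) :
    intOp z k (fun y => f y - g y) x = intOp z k f x - intOp z k g x := by
  simp only [intOp, mul_sub]
  exact intervalIntegral.integral_sub (hf.continuousOn_mul hk.continuousOn)
    (hg.continuousOn_mul hk.continuousOn)

theorem continuousOn_intOp (hz : 0 ≤ z)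
    (hk : ContinuousOn (fun p : ℝ × ℝ => k p.1 p.2) (Icc (-z) z ×ˢ Icc (-z) z))
    (hf : IntervalIntegrable f volume (-z) z) : ContinuousOn (intOp z k f) (Icc (-z) z) := by
  have hI : uIcc (-z) z = Icc (-z) z := uIcc_of_le (by linarith)
  obtain ⟨C, hC⟩ := (isCompact_Icc.prod isCompact_Icc).exists_bound_of_continuousOn hk
  have hsection (x : ℝ) (hx : x ∈ Icc (-z) z) : ContinuousOn (k x) (uIcc (-z) z) :=
    hk.comp (f := fun y => (x, y)) (by fun_prop) fun y hy => ⟨hx, hI ▸ hy⟩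
  intro x₀ hx₀
  refine intervalIntegral.continuousWithinAt_of_dominated_interval (bound := fun y => C * ‖f y‖)
    (eventually_nhdsWithin_of_forall fun x hx => ?_)
    (eventually_nhdsWithin_of_forall fun x hx => .of_forall fun y hy => ?_)
    (hf.norm.const_mul C) (.of_forall fun y hy => ?_)
  · exact (hf.continuousOn_mul (hsection x hx)).def'.aestronglyMeasurable
  · rw [norm_mul]
    exact mul_le_mul_of_nonneg_right (hC (x, y) ⟨hx, hI ▸ uIoc_subset_uIcc hy⟩) (norm_nonneg _)
  · have hy' : y ∈ Icc (-z) z := hI ▸ uIoc_subset_uIcc hy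
    exact ContinuousWithinAt.mul (hk.comp (f := fun x => (x, y)) (by fun_prop)
      (fun x hx => ⟨hx, hy'⟩) x₀ hx₀) continuousWithinAt_const

theorem intOp_intOp {p q : ℝ → ℝ → ℂ} (hz : 0 ≤ z) (hp : Continuous (p x))
    (hq : Continuous (Function.uncurry q)) (hf : IntervalIntegrable f volume (-z) z) :
    intOp z p (intOp z q f) x = intOp z (fun x u => ∫ t in (-z)..z, p x t * q t u) f x := by
  have hzz : -z ≤ z := by linarith
  rw [intervalIntegrable_iff_integrableOn_Icc_of_le hzz] at hf
  have hint : IntegrableOn (fun v : ℝ × ℝ => p x v.1 * q v.1 v.2 * f v.2)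
      (Icc (-z) z ×ˢ Icc (-z) z) (volume.prod volume) := by
    refine IntegrableOn.continuousOn_mul (g := fun v : ℝ × ℝ => p x v.1 * q v.1 v.2)
      (g' := fun v : ℝ × ℝ => f v.2) (by fun_prop) ?_ (isCompact_Icc.prod isCompact_Icc)
    rw [IntegrableOn, ← Measure.prod_restrict]
    exact Integrable.comp_snd hf _
  rw [IntegrableOn, ← Measure.prod_restrict] at hint
  simp only [intOp, intervalIntegral.integral_of_le hzz, ← integral_Icc_eq_integral_Ioc,
    ← integral_const_mul, ← integral_mul_const, ← mul_assoc]
  exact integral_integral_swap hint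

theorem intOp_eq_add {p q r s : ℝ → ℝ → ℂ} (hz : 0 ≤ z) (hp : Continuous (p x))
    (hq : Continuous (Function.uncurry q)) (hr : Continuous (r x)) (hs : Continuous (s x))
    (h : ∀ u ∈ Icc (-z) z, r x u = s x u + ∫ t in (-z)..z, p x t * q t u)
    (hf : IntervalIntegrable f volume (-z) z) :
    intOp z r f x = intOp z s f x + intOp z p (intOp z q f) x := by
  rw [← sub_eq_iff_eq_add', intOp_intOp hz hp hq hf, intOp, intOp,
    ← intervalIntegral.integral_sub (hf.continuousOn_mul hr.continuousOn)
      (hf.continuousOn_mul hs.continuousOn)]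
  refine intervalIntegral.integral_congr fun u hu => ?_
  rw [uIcc_of_le (by linarith)] at hu
  simp only [h u hu]
  ring

end IntOp

/-- The complexification of a real kernel. -/
noncomputable def complexify (k : ℝ → ℝ → ℝ) (x y : ℝ) : ℂ := k x y

theorem continuous_complexify {k : ℝ → ℝ → ℝ} (hk : Continuous (Function.uncurry k)) :
    Continuous (Function.uncurry (complexify k)) :=
  Complex.continuous_ofReal.comp hk

theorem complexify_eq_add {k l m n : ℝ → ℝ → ℝ} {a b x u : ℝ}
    (h : k x u = l x u + ∫ t in a..b, m x t * n t u) : complexify k x u =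
      complexify l x u + ∫ t in a..b, complexify m x t * complexify n t u := by
  simp only [complexify, h, ← Complex.ofReal_mul, intervalIntegral.integral_ofReal,
    Complex.ofReal_add]

theorem sineOp_eq (z : ℝ) (f : ℝ → ℂ) :
    sineOp z f = fun x => f x - intOp z (complexify unitSine) f x := rfl

theorem isSineResolventKernel_complexify {z : ℝ} (hz : 0 < z) :
    IsSineResolventKernel z (complexify (sineResolventKernel z)) := by
  have hk := continuous_complexify continuous_unitSine
  have hQ := continuous_complexify (continuous_sineResolventKernel z)
  have hzz : -z ≤ z := by linarith
  have hint {f : ℝ → ℂ} (hf : MemLp f 2 (volume.restrict (Icc (-z) z))) :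
      IntervalIntegrable f volume (-z) z :=
    (intervalIntegrable_iff_integrableOn_Icc_of_le hzz).2 (hf.integrable one_le_two)
  have hint' {k : ℝ → ℝ → ℂ} {f : ℝ → ℂ} (hk : Continuous (Function.uncurry k))
      (hf : IntervalIntegrable f volume (-z) z) : IntervalIntegrable (intOp z k f) volume (-z) z :=
    (continuousOn_intOp hz.le hk.continuousOn hf).intervalIntegrable_of_Icc hzz
  refine ⟨hQ.continuousOn, fun f hf => ?_, fun f hf => ?_⟩ <;>
  refine ae_restrict_of_forall_mem measurableSet_Icc fun x hx => ?_
  · have h := intOp_eq_add hz.le (hk.uncurry_left x) hQ (hQ.uncurry_left x) (hk.uncurry_left x)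
      (fun u hu => complexify_eq_add (sineResolventKernel_eq_unitSine_mul hz hx hu)) (hint hf)
    simp only [sineOp_eq]
    rw [intOp_add (hk.uncurry_left x) (hint hf) (hint' hQ (hint hf)), h]
    ring
  · have h := intOp_eq_add hz.le (hQ.uncurry_left x) hk (hQ.uncurry_left x) (hk.uncurry_left x)
      (fun u hu => complexify_eq_add (sineResolventKernel_eq_mul_unitSine hz hx hu)) (hint hf)
    rw [sineOp_eq, intOp_sub (hQ.uncurry_left x) (hint hf) (hint' hk (hint hf)), h]
    ring

theorem isSineResolventKernel_sineResolvent {z : ℝ} (hz : 0 < z) :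
    IsSineResolventKernel z (sineResolvent z) := by
  have h : ∃ Q : ℝ → ℝ → ℂ, IsSineResolventKernel z Q := ⟨_, isSineResolventKernel_complexify hz⟩
  rw [sineResolvent, dif_pos h]
  exact h.choose_spec

theorem intOp_eqOn_of_isSineResolventKernel {z : ℝ} (hz : 0 < z) {Q R : ℝ → ℝ → ℂ}
    (hQ : IsSineResolventKernel z Q) (hR : IsSineResolventKernel z R) {f : ℝ → ℂ}
    (hf : Continuous f) : EqOn (intOp z Q f) (intOp z R f) (Icc (-z) z) := by
  have hmem {g : ℝ → ℂ} (hg : ContinuousOn g (Icc (-z) z)) :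
      MemLp g 2 (volume.restrict (Icc (-z) z)) := by
    obtain ⟨C, hC⟩ := isCompact_Icc.exists_bound_of_continuousOn hg
    exact MemLp.of_bound (hg.aestronglyMeasurable measurableSet_Icc) C
      (ae_restrict_of_forall_mem measurableSet_Icc hC)
  have hfi := hf.intervalIntegrable (μ := volume) (-z) z
  have hRc := continuousOn_intOp hz.le hR.continuousOn hfi
  have hright := hR.right_inv f (hmem hf.continuousOn)
  have hleft := hQ.left_inv (fun y => f y + intOp z R f y) (hmem (hf.continuousOn.add hRc))
  refine Measure.eqOn_Icc_of_ae_eq volume (by linarith) ?_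
    (continuousOn_intOp hz.le hQ.continuousOn hfi) hRc
  filter_upwards [hright, hleft] with x hx hx'
  rw [intOp_congr_ae Q hright hz.le x, hx] at hx'
  exact add_left_cancel hx'

/-! ### The function `r` -/

/-- The left endpoint of `[-1, 1]`. -/
def leftEnd : 𝕁 := ⟨-1, by norm_num⟩

theorem mul_leftEnd (z : ℝ) : z * (leftEnd : ℝ) = -z := mul_neg_one z

/-- The diagonal value at the endpoint `-1` of the resolvent kernel of `sineOperator z`. -/
noncomputable def endpointResolvent (z : ℝ) : ℝ := resolventSection z leftEnd leftEnd

theorem hasDerivAt_endpointResolvent (z : ℝ) : HasDerivAt endpointResolvent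
    (∑ i, Ring.inverse (1 - sineOperator z) (waves i z) leftEnd ^ 2) z :=
  hasDerivAt_apply_resolventVector pairing_comm (isUnit_one_sub_sineOperator z)
    (ContinuousMap.evalCLM ℝ leftEnd)

theorem endpointResolvent_zero : endpointResolvent 0 = 0 := by
  rw [endpointResolvent, resolventSection, resolventVector_zero, ContinuousMap.zero_apply]

theorem sineResolventKernel_neg_neg {z : ℝ} (hz : z ≠ 0) :
    sineResolventKernel z (-z) (-z) = z⁻¹ * endpointResolvent z := by
  simpa only [mul_leftEnd, endpointResolvent] using
    sineResolventKernel_mul_mul hz leftEnd leftEnd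

theorem inverse_one_sub_sineOperator_apply_leftEnd {z : ℝ} (hz : z ≠ 0) (g : C(ℝ, ℝ)) :
    Ring.inverse (1 - sineOperator z) (rescale z g) leftEnd =
      g (-z) + ∫ s in (-z)..z, sineResolventKernel z (-z) s * g s := by
  simpa only [mul_leftEnd] using inverse_one_sub_sineOperator_rescale hz g leftEnd

theorem sineR_eq_add_intOp (z : ℝ) : sineR z =
    Complex.exp (-(Complex.I * (-z : ℝ) * Real.pi)) +
      intOp z (sineResolvent z) (fun s => Complex.exp (-(Complex.I * s * Real.pi))) (-z) := by
  simp [sineR, intOp]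

/-- The function `cos (π ·)`. -/
noncomputable def cosPi : C(ℝ, ℝ) := ⟨fun s => Real.cos (Real.pi * s), by fun_prop⟩

/-- The function `sin (π ·)`. -/
noncomputable def sinPi : C(ℝ, ℝ) := ⟨fun s => Real.sin (Real.pi * s), by fun_prop⟩

theorem waves_zero_eq_rescale (z : ℝ) : waves 0 z = rescale z cosPi := by
  ext t
  rw [waves_zero_apply, mul_comm z, mul_assoc]
  rfl

theorem waves_one_eq_rescale (z : ℝ) : waves 1 z = rescale z sinPi := by
  ext t
  rw [waves_one_apply, mul_comm z, mul_assoc]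
  rfl

theorem exp_neg_I_mul_pi (s : ℝ) :
    Complex.exp (-(Complex.I * s * Real.pi)) = cosPi s - sinPi s * Complex.I := by
  rw [show -(Complex.I * s * Real.pi) = -(Real.pi * s) * Complex.I by ring, Complex.exp_mul_I,
    Complex.cos_neg, Complex.sin_neg, neg_mul, ← sub_eq_add_neg]
  simp [cosPi, sinPi]

theorem intOp_complexify {k : ℝ → ℝ → ℝ} {x : ℝ} (hk : Continuous (k x)) (z : ℝ) (g h : C(ℝ, ℝ)) :
    intOp z (complexify k) (fun s => g s - h s * Complex.I) x =
      (∫ s in (-z)..z, k x s * g s : ℝ) - (∫ s in (-z)..z, k x s * h s : ℝ) * Complex.I := by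
  have hint (g : C(ℝ, ℝ)) :
      IntervalIntegrable (fun s => ((k x s * g s : ℝ) : ℂ)) volume (-z) z :=
    Continuous.intervalIntegrable (by fun_prop) _ _
  rw [← intervalIntegral.integral_ofReal, ← intervalIntegral.integral_ofReal,
    ← intervalIntegral.integral_mul_const,
    ← intervalIntegral.integral_sub (hint g) ((hint h).mul_const _)]
  simp only [intOp, complexify, Complex.ofReal_mul, mul_sub, mul_assoc]

theorem sineR_eq {z : ℝ} (hz : 0 < z) : sineR z =
    (Ring.inverse (1 - sineOperator z) (waves 0 z) leftEnd : ℂ) -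
      (Ring.inverse (1 - sineOperator z) (waves 1 z) leftEnd : ℂ) * Complex.I := by
  have hunique := intOp_eqOn_of_isSineResolventKernel hz (isSineResolventKernel_sineResolvent hz)
    (isSineResolventKernel_complexify hz)
    (f := fun s => Complex.exp (-(Complex.I * s * Real.pi))) (by fun_prop)
    (left_mem_Icc.2 (by linarith))
  rw [sineR_eq_add_intOp, hunique, waves_zero_eq_rescale, waves_one_eq_rescale,
    inverse_one_sub_sineOperator_apply_leftEnd hz.ne',
    inverse_one_sub_sineOperator_apply_leftEnd hz.ne']
  simp only [exp_neg_I_mul_pi]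
  rw [intOp_complexify ((continuous_sineResolventKernel z).uncurry_left (-z))]
  push_cast
  ring

theorem norm_sineR_sq {z : ℝ} (hz : 0 < z) :
    ‖sineR z ^ 2‖ = ∑ i, Ring.inverse (1 - sineOperator z) (waves i z) leftEnd ^ 2 := by
  rw [norm_pow, ← Complex.normSq_eq_norm_sq, sineR_eq hz, sub_eq_add_neg, ← neg_mul,
    ← Complex.ofReal_neg, Complex.normSq_add_mul_I, neg_sq, Fin.sum_univ_two]

theorem hasDerivAt_endpointResolvent_of_pos {z : ℝ} (hz : 0 < z) :
    HasDerivAt endpointResolvent ‖sineR z ^ 2‖ z :=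
  norm_sineR_sq hz ▸ hasDerivAt_endpointResolvent z

theorem differentiable_endpointResolvent : Differentiable ℝ endpointResolvent := fun z =>
  (hasDerivAt_endpointResolvent z).differentiableAt

theorem intervalIntegrable_norm_sineR_sq {z : ℝ} (hz : 0 ≤ z) :
    IntervalIntegrable (fun s => ‖sineR s ^ 2‖) volume 0 z :=
  (intervalIntegrable_iff_integrableOn_Ioc_of_le hz).2 <|
    intervalIntegral.integrableOn_deriv_of_nonneg
      differentiable_endpointResolvent.continuous.continuousOn
      (fun _ hs => hasDerivAt_endpointResolvent_of_pos hs.1) fun _ _ => norm_nonneg _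

theorem integral_norm_sineR_sq {z : ℝ} (hz : 0 ≤ z) :
    ∫ s in (0 : ℝ)..z, ‖sineR s ^ 2‖ = endpointResolvent z := by
  rw [intervalIntegral.integral_eq_sub_of_hasDerivAt_of_le hz
    differentiable_endpointResolvent.continuous.continuousOn
    (fun s hs => hasDerivAt_endpointResolvent_of_pos hs.1)
    (intervalIntegrable_norm_sineR_sq hz), endpointResolvent_zero, sub_zero]

/-! ### The logarithmic derivative of the determinant -/

/-- The value at `(-z, -z)` of the resolvent kernel of `unitSine` on `[-z, z]`, extended
continuously to `z = 0`. -/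
noncomputable def endpointDensity : ℝ → ℝ := dslope endpointResolvent 0

theorem continuous_endpointDensity : Continuous endpointDensity := by
  rw [← continuousOn_univ, endpointDensity, continuousOn_dslope univ_mem]
  exact ⟨differentiable_endpointResolvent.continuous.continuousOn,
    differentiable_endpointResolvent 0⟩

theorem mul_endpointDensity (z : ℝ) : z * endpointDensity z = endpointResolvent z := by
  simpa [endpointResolvent_zero, endpointDensity] using sub_smul_dslope endpointResolvent 0 z

theorem fredholmMinor_endpoint {z : ℝ} (hz : 0 < z) : fredholmMinor unitSine (-z) z (-z) (-z) =
    endpointDensity z * fredholmDet (-z) z unitSine 1 := by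
  have hmem : -z ∈ Icc (-z) z := left_mem_Icc.2 (by linarith)
  rw [fredholmMinor_unitSine hz hmem hmem, sineResolventKernel_neg_neg hz.ne',
    ← mul_endpointDensity, inv_mul_cancel_left₀ hz.ne', mul_comm]

theorem sineDet_one_eq_fredholmDet {z : ℝ} (hz : 0 ≤ z) :
    sineDet z 1 = fredholmDet (-z) z unitSine 1 := by
  have h := fredholmDet_affine unitSine hz (-1) 1 0
  simp only [zero_add, mul_neg, mul_one, ← sineKernel_eq] at h
  exact h.symm

theorem sineDet_one_eq_one_sub {z : ℝ} (hz : 0 ≤ z) :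
    sineDet z 1 = 1 - 2 * ∫ t in (0 : ℝ)..z, fredholmMinor unitSine (-t) t (-t) (-t) := by
  rw [sineDet_one_eq_fredholmDet hz,
    fredholmDet_neg_self_eq continuous_unitSine abs_unitSine_le unitSine_add_add hz]

theorem continuousOn_fredholmMinor_endpoint (z : ℝ) :
    ContinuousOn (fun t => fredholmMinor unitSine (-t) t (-t) (-t)) (Icc 0 z) := by
  refine (continuousOn_fredholmMinor continuous_unitSine abs_unitSine_le continuous_neg
    continuous_id continuous_neg continuous_neg (2 * z)).mono fun t ht => ⟨?_, ?_⟩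
  · exact neg_le_self ht.1
  · change t - -t ≤ 2 * z
    linarith [ht.2]

theorem continuousOn_sineDet_one {z : ℝ} (hz : 0 ≤ z) :
    ContinuousOn (fun t => sineDet t 1) (Icc 0 z) := by
  refine ContinuousOn.congr ?_ fun t ht => sineDet_one_eq_one_sub ht.1
  refine continuousOn_const.sub (continuousOn_const.mul ?_)
  rw [← uIcc_of_le hz]
  refine intervalIntegral.continuousOn_primitive_interval (μ := volume) ?_
  rw [uIcc_of_le hz]
  exact (continuousOn_fredholmMinor_endpoint z).integrableOn_compact isCompact_Icc

theorem hasDerivAt_sineDet_one {z : ℝ} (hz : 0 < z) :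
    HasDerivAt (fun z => sineDet z 1) (-(2 * endpointDensity z) * sineDet z 1) z := by
  have hcont := continuousOn_fredholmMinor_endpoint (z + 1)
  have hint := intervalIntegral.integral_hasDerivAt_right
    ((hcont.mono (Icc_subset_Icc_right (by linarith))).intervalIntegrable_of_Icc hz.le)
    (hcont.mono Ioo_subset_Icc_self |>.stronglyMeasurableAtFilter isOpen_Ioo z ⟨hz, lt_add_one z⟩)
    (hcont.continuousAt (Icc_mem_nhds hz (lt_add_one z)))
  refine ((hint.const_mul 2).const_sub 1).congr_of_eventuallyEq ?_ |>.congr_deriv ?_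
  · filter_upwards [Ioi_mem_nhds hz] with t ht
    exact sineDet_one_eq_one_sub (le_of_lt ht)
  · rw [fredholmMinor_endpoint hz, sineDet_one_eq_fredholmDet hz.le]
    ring

theorem pos_of_hasDerivAt_mul {u q : ℝ → ℝ} {a b : ℝ} (hab : a ≤ b) (hq : Continuous q)
    (hu : ContinuousOn u (Icc a b)) (hderiv : ∀ t ∈ Ioo a b, HasDerivAt u (q t * u t) t)
    (ha : 0 < u a) : 0 < u b := by
  set I : ℝ → ℝ := fun t => Real.exp (-∫ s in a..t, q s)
  have hI (t : ℝ) : HasDerivAt I (I t * -q t) t :=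
    (hq.integral_hasStrictDerivAt a t).hasDerivAt.neg.exp
  have hconst : u b * I b = u a * I a := by
    rcases hab.eq_or_lt with rfl | hlt
    · rfl
    obtain ⟨c, -, hslope⟩ := exists_hasDerivAt_eq_slope (fun t => u t * I t) _ hlt
      (hu.mul fun t _ => (hI t).continuousAt.continuousWithinAt)
      fun t ht => (hderiv t ht).mul (hI t)
    rw [eq_div_iff (sub_pos.2 hlt).ne'] at hslope
    linear_combination -hslope
  have hprod : 0 < u b * I b := hconst ▸ mul_pos ha (Real.exp_pos _)
  exact pos_of_mul_pos_left hprod (Real.exp_pos _).le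

theorem sineDet_one_pos {z : ℝ} (hz : 0 ≤ z) : 0 < sineDet z 1 := by
  have hq : Continuous fun t => -(2 * endpointDensity t) :=
    (continuous_const.mul continuous_endpointDensity).neg
  refine pos_of_hasDerivAt_mul (u := fun t => sineDet t 1) hz hq (continuousOn_sineDet_one hz)
    (fun t ht => hasDerivAt_sineDet_one ht.1) ?_
  simp [sineDet_one_eq_one_sub]

theorem hasDerivAt_log_sineDet_one {z : ℝ} (hz : 0 < z) :
    HasDerivAt (fun z => Real.log (sineDet z 1)) (-(2 * endpointDensity z)) z := by
  have hpos := (sineDet_one_pos hz.le).ne'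
  exact ((hasDerivAt_sineDet_one hz).log hpos).congr_deriv (mul_div_cancel_right₀ _ hpos)

end SineKernel

open SineKernel MeasureTheory Set Filter Topology

theorem corollary4p7 (ζ : ℝ) (hζ : 0 < ζ) :
    IsSineResolventKernel ζ (sineResolvent ζ) ∧
    0 < sineDet ζ 1 ∧
    DifferentiableAt ℝ (fun z : ℝ => Real.log (sineDet z 1)) ζ ∧
    IntervalIntegrable (fun s : ℝ => ‖sineR s ^ 2‖) volume 0 ζ ∧
    ζ * deriv (fun z : ℝ => Real.log (sineDet z 1)) ζ = -(2 * ∫ s in (0 : ℝ)..ζ, ‖sineR s ^ 2‖) := by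
  have hlog := hasDerivAt_log_sineDet_one hζ
  refine ⟨isSineResolventKernel_sineResolvent hζ, sineDet_one_pos hζ.le, hlog.differentiableAt,
    intervalIntegrable_norm_sineR_sq hζ.le, ?_⟩
  rw [hlog.deriv, integral_norm_sineR_sq hζ.le, ← mul_endpointDensity]
  ring
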